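/- \textbf{Theorem (functorial Cartier duality).} Let $R$ be a commutative ring. All functors are covariant functors on the category of commutative $R$-algebras. For an $R$-module $M$ let $\mathcal M^*$ be the functor $S\mapsto \mathrm{Hom}_R(M,S)=\mathrm{Hom}_S(M\otimes_R S,S)$. For a commutative $R$-algebra $S$ let $\mathcal S$ be the functor of algebras $T\mapsto T\otimes_R S$; in particular $\mathcal R(T)=T$. A commutative algebra scheme is a functor $\mathcal M^*$ endowed with a structure of functor of commutative $\mathcal R$-algebras (compatible with its $\mathcal R$-module structure); its spectrum is the functor of sets $(\mathrm{Spec}\,\mathcal M^*)(S)=\mathrm{Hom}_{\mathcal R\text{-alg}}(\mathcal M^*,\mathcal S)$. An affine scheme $\mathrm{Spec}\,A$ is identified with its functor of points $S\mapsto \mathrm{Hom}_{R\text{-alg}}(A,S)$. An \emph{abelian affine $R$-monoid scheme} (with projective functions) is a functor of abelian monoids whose underlying functor of sets is isomorphic to $\mathrm{Spec}\,A$ for some commutative $R$-algebra $A$ that is projective as an $R$-module. An \emph{abelian formal monoid} is a functor of abelian monoids whose underlying functor of sets is isomorphic to $\mathrm{Spec}\,\mathcal M^*$ for some commutative algebra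 scheme $\mathcal M^*$ with $M$ a projective $R$-module. Morphisms are natural transformations by monoid homomorphisms. For a functor of abelian monoids $\mathbb G$, the dual monoid $\mathbb G^*=\mathbb Hom_{mon}(\mathbb G,\mathcal R)$ is the functor that sends $S$ to the monoid, under pointwise product, of morphisms of functors of monoids from $\mathbb G_{|S}$ to $S'\mapsto (S',\cdot)$ on commutative $S$-algebras. Then: \begin{enumerate} \item Let $M$ be a projective $R$-module. If $\mathbb G$ is a functor of abelian monoids whose underlying functor of sets is isomorphic to $\mathrm{Spec}\,A$ for a commutative $R$-algebra $A$ with underlying module isomorphic to $M$, then the functor of sets underlying $\mathbb G^*$ is isomorphic to $\mathrm{Spec}\,\mathcal M^*$ for some commutative algebra scheme structure on $\mathcal M^*$. Conversely, if the functor of sets underlying $\mathbb G$ is isomorphic to $\mathrm{Spec}\,\mathcal M^*$ for some commutative algebra scheme structure on $\mathcal M^*$, then that of $\mathbb G^*$ is isomorphic to $\mathrm{Spec}\,A$ for some commutative $R$-algebra $A$ with underlying module isomorphic to $M$. \item If $\mathbb G$ is an abelian affine $R$-monoid scheme with projective functions or an abelian formal monoid, then the morphism $\mathbb G\to\mathbb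 G^{**}$, $g\mapsto (f\mapsto f(g))$, is an isomorphism. \item $\mathbb G\mapsto\mathbb G^*$ induces an anti-equivalence between the category of abelian affine $R$-monoid schemes with projective functions and the category of abelian formal monoids. A quasi-inverse is again $\mathbb G\mapsto\mathbb G^*$, and the natural isomorphisms between the identity functors and the two composites are given by $\mathbb G\to\mathbb G^{**}$. \end{enumerate} -/

import Mathlib

open CategoryTheory Opposite
open scoped TensorProduct

universe u

namespace FunctorialCartier

/-! All functors are covariant functors on the category `CommAlgCat R` of commutative
`R`-algebras (in the universe of `R`). -/

/-- Functors of abelian monoids (morphisms: natural transformations by monoid homomorphisms).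
Their values may be large, since duals are made of families indexed by all commutative
`R`-algebras. -/
abbrev MonFunctor (R : Type u) [CommRing R] : Type (u + 2) :=
  CommAlgCat.{u} R ⥤ CommMonCat.{u + 1}

/-! ### Functors of commutative algebras and their spectra -/

/-- A functor of commutative `𝓡`-algebras, where `𝓡(T) = T`: a functor of commutative rings
with a `T`-algebra structure on its value at `T`, natural in `T`. -/
structure CommAlgFunctor (R : Type u) [CommRing R] where
  obj : CommAlgCat.{u} R → Type u
  [commRing : ∀ T, CommRing (obj T)]
  [algebra : ∀ T : CommAlgCat.{u} R, Algebra T (obj T)]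
  map : ∀ {T T' : CommAlgCat.{u} R}, (T ⟶ T') → (obj T →+* obj T')
  map_algebraMap : ∀ {T T' : CommAlgCat.{u} R} (f : T ⟶ T') (t : T),
    map f (algebraMap T (obj T) t) = algebraMap T' (obj T') (f.hom t)
  map_id : ∀ (T : CommAlgCat.{u} R) (a : obj T), map (𝟙 T) a = a
  map_comp : ∀ {T T' T'' : CommAlgCat.{u} R} (f : T ⟶ T') (g : T' ⟶ T'') (a : obj T),
    map (f ≫ g) a = map g (map f a)

attribute [instance] CommAlgFunctor.commRing CommAlgFunctor.algebra

/-- Morphisms of functors of commutative `𝓡`-algebras. -/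
@[ext]
structure CommAlgFunctor.Hom {R : Type u} [CommRing R] (𝔸 𝔹 : CommAlgFunctor R) where
  app : ∀ T : CommAlgCat.{u} R, 𝔸.obj T →ₐ[T] 𝔹.obj T
  naturality : ∀ {T T' : CommAlgCat.{u} R} (f : T ⟶ T') (a : 𝔸.obj T),
    app T' (𝔸.map f a) = 𝔹.map f (app T a)

/-- The quasi-coherent algebra `T ↦ T ⊗[R] S` of a commutative `R`-algebra `S`. -/
noncomputable def quasiCoherent {R : Type u} [CommRing R] (S : CommAlgCat.{u} R) :
    CommAlgFunctor R where
  obj T := T ⊗[R] S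
  map f := (Algebra.TensorProduct.map f.hom (AlgHom.id R S)).toRingHom
  map_algebraMap f t := by simp
  map_id T a := by simp
  map_comp f g a := by
    induction a using TensorProduct.induction_on with
    | zero => simp
    | tmul x y => simp
    | add x y hx hy => simp only [map_add, hx, hy]

/-- The morphism of quasi-coherent algebras induced by a morphism of `R`-algebras. -/
noncomputable def quasiCoherentMap {R : Type u} [CommRing R] {S S' : CommAlgCat.{u} R}
    (g : S ⟶ S') : (quasiCoherent S).Hom (quasiCoherent S') where
  app T := Algebra.TensorProduct.map (AlgHom.id T T) g.hom
  naturality {T T'} f a := by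
    change T ⊗[R] S at a
    change Algebra.TensorProduct.map (AlgHom.id T' T') g.hom
        (Algebra.TensorProduct.map f.hom (AlgHom.id R S) a) =
      Algebra.TensorProduct.map f.hom (AlgHom.id R S')
        (Algebra.TensorProduct.map (AlgHom.id T T) g.hom a)
    induction a using TensorProduct.induction_on with
    | zero => simp
    | tmul x y => simp
    | add x y hx hy => simp only [map_add, hx, hy]

/-- The spectrum of a functor of commutative `𝓡`-algebras:
`S ↦ Hom_{𝓡-alg}(𝔸, 𝓢)`, with `𝓢` the quasi-coherent algebra of `S`. -/
noncomputable def CommAlgFunctor.spec {R : Type u} [CommRing R] (𝔸 : CommAlgFunctor R) :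
    CommAlgCat.{u} R ⥤ Type (u + 1) where
  obj S := 𝔸.Hom (quasiCoherent S)
  map g := TypeCat.ofHom fun φ =>
    { app := fun T => ((quasiCoherentMap g).app T).comp (φ.app T)
      naturality := fun f a => by
        simp only [AlgHom.comp_apply, φ.naturality, (quasiCoherentMap g).naturality] }
  map_id S := by
    ext φ
    exact DFunLike.congr_fun
      (Algebra.TensorProduct.map_id : Algebra.TensorProduct.map (AlgHom.id _ _) (AlgHom.id R S) = _)
      (φ.app _ _)
  map_comp f g := by
    ext φ
    exact DFunLike.congr_fun
      (Algebra.TensorProduct.map_comp (AlgHom.id _ _) (AlgHom.id _ _) g.hom f.hom) (φ.app _ _)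

/-- The functor of points `S ↦ Hom_{R-alg}(A, S)` of the affine `R`-scheme `Spec A`. -/
def affineScheme {R : Type u} [CommRing R] (A : CommAlgCat.{u} R) :
    CommAlgCat.{u} R ⥤ Type (u + 1) :=
  coyoneda.obj (op A) ⋙ uliftFunctor.{u + 1, u}

/-- `𝔸` is a commutative algebra scheme with underlying `𝓡`-module scheme `𝓜^*`, the dual of
the quasi-coherent module of `M`, i.e. `𝓜^*(T) = Hom_T(M ⊗[R] T, T) = Hom_R(M, T)`: a
`T`-linear isomorphism `𝓜^*(T) ≃ 𝔸(T)`, natural in `T`. -/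
structure ModuleSchemeIso {R : Type u} [CommRing R] (M : Type u) [AddCommGroup M] [Module R M]
    (𝔸 : CommAlgFunctor R) where
  equiv : ∀ T : CommAlgCat.{u} R, (M →ₗ[R] T) ≃ₗ[T] 𝔸.obj T
  naturality : ∀ {T T' : CommAlgCat.{u} R} (f : T ⟶ T') (w : M →ₗ[R] T),
    equiv T' (f.hom.toLinearMap ∘ₗ w) = 𝔸.map f (equiv T w)

/-! ### Affine monoid schemes and formal monoids -/

/-- The functor of sets underlying `G` is the affine scheme `Spec A`, for some commutative
`R`-algebra `A` whose underlying module is `M`. -/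
def IsAffineOn {R : Type u} [CommRing R] (M : Type u) [AddCommGroup M] [Module R M]
    (G : MonFunctor R) : Prop :=
  ∃ A : CommAlgCat.{u} R, Nonempty (A ≃ₗ[R] M) ∧
    Nonempty (G ⋙ forget CommMonCat ≅ affineScheme A)

/-- The functor of sets underlying `G` is `Spec 𝓜^*`, for some structure of commutative
algebra scheme on the module scheme `𝓜^*`. -/
def IsFormalOn {R : Type u} [CommRing R] (M : Type u) [AddCommGroup M] [Module R M]
    (G : MonFunctor R) : Prop :=
  ∃ 𝔸 : CommAlgFunctor R, Nonempty (ModuleSchemeIso M 𝔸) ∧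
    Nonempty (G ⋙ forget CommMonCat ≅ 𝔸.spec)

/-- Abelian affine `R`-monoid schemes `Spec A` with `A` a projective `R`-module. -/
def IsAffineMonoidScheme (R : Type u) [CommRing R] : ObjectProperty (MonFunctor R) := fun G =>
  ∃ (M : Type u) (_ : AddCommGroup M) (_ : Module R M), Module.Projective R M ∧ IsAffineOn M G

/-- Abelian formal monoids `Spec 𝓜^*` with `M` a projective `R`-module. -/
def IsFormalMonoid (R : Type u) [CommRing R] : ObjectProperty (MonFunctor R) := fun G =>
  ∃ (M : Type u) (_ : AddCommGroup M) (_ : Module R M), Module.Projective R M ∧ IsFormalOn M G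

/-! ### The dual monoid -/

/-- Morphisms of functors of monoids `G_{|S} ⟶ 𝓢`, where `𝓢(T) = T` is regarded as a monoid
with its product. A commutative `S`-algebra is a commutative `R`-algebra `T` with a morphism
of `R`-algebras `S ⟶ T`. -/
@[ext]
structure Character {R : Type u} [CommRing R] (G : MonFunctor R) (S : CommAlgCat.{u} R) :
    Type (u + 1) where
  app : ∀ T : CommAlgCat.{u} R, (S ⟶ T) → (G.obj T →* T)
  naturality : ∀ {T T' : CommAlgCat.{u} R} (s : S ⟶ T) (f : T ⟶ T') (g : G.obj T),
    app T' (s ≫ f) ((G.map f).hom g) = f.hom (app T s g)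

namespace Character

variable {R : Type u} [CommRing R] {G H : MonFunctor R} {S S' : CommAlgCat.{u} R}

instance : One (Character G S) :=
  ⟨{ app := fun _ _ => 1, naturality := fun _ _ _ => by simp }⟩

instance : Mul (Character G S) :=
  ⟨fun χ ψ =>
    { app := fun T s => χ.app T s * ψ.app T s
      naturality := fun s f g => by simp [χ.naturality, ψ.naturality] }⟩

@[simp]
theorem one_app (T : CommAlgCat.{u} R) (s : S ⟶ T) : (1 : Character G S).app T s = 1 := rfl

@[simp]
theorem mul_app (χ ψ : Character G S) (T : CommAlgCat.{u} R) (s : S ⟶ T) :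
    (χ * ψ).app T s = χ.app T s * ψ.app T s := rfl

/-- The product of characters is the pointwise one. -/
instance : CommMonoid (Character G S) where
  mul_assoc _ _ _ := by ext; simp [mul_assoc]
  one_mul _ := by ext; simp
  mul_one _ := by ext; simp
  mul_comm _ _ := by ext; simp [mul_comm]

/-- Restriction along `S ⟶ S'`. -/
def restrict (f : S ⟶ S') : Character G S →* Character G S' where
  toFun χ :=
    { app := fun T s => χ.app T (f ≫ s)
      naturality := fun s h g => by rw [← Category.assoc, χ.naturality] }
  map_one' := rfl
  map_mul' _ _ := rfl

/-- Precomposition with a morphism of functors of monoids `G ⟶ H`. -/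
def precomp (α : G ⟶ H) : Character H S →* Character G S where
  toFun χ :=
    { app := fun T s => (χ.app T s).comp (α.app T).hom
      naturality := fun s f g => by
        have h : (α.app _).hom ((G.map f).hom g) = (H.map f).hom ((α.app _).hom g) :=
          ConcreteCategory.congr_hom (α.naturality f) g
        simp [h, χ.naturality] }
  map_one' := rfl
  map_mul' _ _ := rfl

end Character

/-- The dual monoid `G^* = 𝐇𝐨𝐦_mon(G, 𝓡)`. -/
def dualObj {R : Type u} [CommRing R] (G : MonFunctor R) : MonFunctor R where
  obj S := CommMonCat.of (Character G S)
  map f := CommMonCat.ofHom (Character.restrict f)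
  map_id S := by
    ext χ T s x
    exact DFunLike.congr_fun (congrArg (Character.app χ T) (Category.id_comp s)) x
  map_comp f g := by
    ext χ T s x
    exact DFunLike.congr_fun (congrArg (Character.app χ T) (Category.assoc f g s)) x

/-- The contravariant functor `G ↦ G^*`. -/
def dual (R : Type u) [CommRing R] : (MonFunctor R)ᵒᵖ ⥤ MonFunctor R where
  obj G := dualObj G.unop
  map α := { app := fun _ => CommMonCat.ofHom (Character.precomp α.unop) }
  map_id _ := rfl
  map_comp _ _ := rfl

/-- The natural morphism `G ⟶ G^{**}`, `g ↦ (χ ↦ χ(g))`. -/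
def bidual {R : Type u} [CommRing R] (G : MonFunctor R) : G ⟶ dualObj (dualObj G) where
  app S := CommMonCat.ofHom
    { toFun := fun g =>
        { app := fun T s =>
            { toFun := fun χ => Character.app χ T (𝟙 T) ((G.map s).hom g)
              map_one' := rfl
              map_mul' := fun _ _ => rfl }
          naturality := fun {T T'} s f χ => by
            have h : (G.map (s ≫ f)).hom g = (G.map f).hom ((G.map s).hom g) := by simp
            change Character.app χ T' (f ≫ 𝟙 T') ((G.map (s ≫ f)).hom g) =
              f.hom (Character.app χ T (𝟙 T) ((G.map s).hom g))
            rw [h, Category.comp_id]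
            have h' := Character.naturality χ (𝟙 T) f ((G.map s).hom g)
            rwa [Category.id_comp] at h' }
      map_one' := by
        refine Character.ext (funext fun T => funext fun s => MonoidHom.ext fun χ => ?_)
        change Character.app χ T (𝟙 T) ((G.map s).hom 1) = 1
        simp
      map_mul' := fun a b => by
        refine Character.ext (funext fun T => funext fun s => MonoidHom.ext fun χ => ?_)
        change Character.app χ T (𝟙 T) ((G.map s).hom (a * b)) =
          Character.app χ T (𝟙 T) ((G.map s).hom a) * Character.app χ T (𝟙 T) ((G.map s).hom b)
        simp }
  naturality S S' f := by
    ext g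
    refine Character.ext (funext fun T => funext fun s => MonoidHom.ext fun χ => ?_)
    change Character.app χ T (𝟙 T) ((G.map s).hom ((G.map f).hom g)) =
      Character.app χ T (𝟙 T) ((G.map (f ≫ s)).hom g)
    simp

/-- Given that `G ↦ G^*` carries affine monoid schemes to formal monoids, the induced functor
`(abelian affine monoid schemes)ᵒᵖ ⥤ (abelian formal monoids)`. -/
def dualOfAffine {R : Type u} [CommRing R]
    (h : ∀ G : MonFunctor R, IsAffineMonoidScheme R G → IsFormalMonoid R (dualObj G)) :
    (IsAffineMonoidScheme R).FullSubcategoryᵒᵖ ⥤ (IsFormalMonoid R).FullSubcategory :=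
  (IsFormalMonoid R).lift ((IsAffineMonoidScheme R).ι.op ⋙ dual R) fun G => h _ G.unop.property

/-- Given that `G ↦ G^*` carries formal monoids to affine monoid schemes, the induced functor
`(abelian formal monoids) ⥤ (abelian affine monoid schemes)ᵒᵖ`. -/
def dualOfFormal {R : Type u} [CommRing R]
    (h : ∀ G : MonFunctor R, IsFormalMonoid R G → IsAffineMonoidScheme R (dualObj G)) :
    (IsFormalMonoid R).FullSubcategory ⥤ (IsAffineMonoidScheme R).FullSubcategoryᵒᵖ :=
  Functor.rightOp
    ((IsAffineMonoidScheme R).lift ((IsFormalMonoid R).ι.op ⋙ dual R) fun G => h _ G.unop.property)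

end FunctorialCartier

open FunctorialCartier

/-! The basis is a reflexivity statement: a natural family of homogeneous maps `Hom(M, T) → T ⊗ N`
is contraction with a unique element of `M ⊗ N` (`exists_eq_rTensor`, `eq_of_rTensor_eq`). Hence an
`S`-point of `Spec 𝓜^*` is an element of `M ⊗ S` against which contraction respects products and
units.

From affine to formal: if `G = Spec A`, Yoneda turns a character of `G` over `S` into a function in
`A ⊗ S`. Multiplicativity of the character says that this function is grouplike for the
comultiplication of `A`, which amounts to contraction with it being multiplicative for convolution
on `Hom(A, T)`. So `G^*` is the spectrum of the dual of `A` with the convolution product.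

From formal to affine, projectivity enters: any finite subset of `M` is fixed by an endomorphism `t`
of finite rank. The points of `G` fixed by `t` form an affine scheme, whose algebra is a quotient of
`𝔸(R)`, and `G` is the union of these. Evaluation at a given `m` descends to that quotient once `t`
fixes enough elements, so the points of `G` span `M`. Therefore a natural map from `G` to the
quasi-coherent module of `N` comes from a unique linear map `M → N` (`exists_eq_rTensor_pt`,
`linearMap_ext`), and likewise for `G × G` and bilinear maps. The monoid law then makes `M` a
commutative algebra `A`, and characters over `S` become algebra morphisms `A ⟶ S`.

Under these identifications `bidual` matches the points of `G` with the characters of its dual. In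
the formal case this requires that convolution on the dual of `A` recover the original product of
the algebra scheme (`mul_eq_convolution`). The anti-equivalence then follows from naturality of
`bidual`. -/

namespace FunctorialCartier

open LinearMap (rTensor lTensor)
open Module (Dual)

variable {R : Type u} [CommRing R]

/-! ### Reflexivity: natural homogeneous families as tensors -/

section Reflexivity

variable {M N : Type u} [AddCommGroup M] [Module R M] [AddCommGroup N] [Module R N]

/-- Two elements of `M ⊗ N` with the same contractions against all linear maps from `M` to
commutative algebras are equal. -/
theorem eq_of_rTensor_eq {x y : M ⊗[R] N}
    (h : ∀ (T : CommAlgCat.{u} R) (w : M →ₗ[R] T), rTensor N w x = rTensor N w y) : x = y := by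
  let _ : Module Rᵐᵒᵖ M := Module.compHom M ((RingHom.id R).fromOpposite mul_comm)
  have : IsCentralScalar R M := ⟨fun _ _ => rfl⟩
  -- One algebra suffices: the inclusion of `M` in the square-zero extension `R ⊕ εM` is split by
  -- the projection, so contraction against it is injective.
  have h1 := congrArg (rTensor N (TrivSqZeroExt.sndHom R M))
    (h (.of R (TrivSqZeroExt R M)) (TrivSqZeroExt.inrHom R M))
  have h2 : TrivSqZeroExt.sndHom R M ∘ₗ TrivSqZeroExt.inrHom R M = LinearMap.id := by
    ext; simp
  simpa only [← LinearMap.comp_apply, ← LinearMap.rTensor_comp, h2, LinearMap.rTensor_id,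
    LinearMap.id_apply] using h1

/-- A natural family of homogeneous maps `Hom(M, T) → T ⊗ N` is given by contraction with an
element of `M ⊗ N`. -/
theorem exists_eq_rTensor (φ : ∀ T : CommAlgCat.{u} R, (M →ₗ[R] T) → T ⊗[R] N)
    (hsmul : ∀ (T : CommAlgCat.{u} R) (t : T) w, φ T (t • w) = t • φ T w)
    (hnat : ∀ {T T' : CommAlgCat.{u} R} (f : T ⟶ T') (w : M →ₗ[R] T),
      φ T' (f.hom.toLinearMap ∘ₗ w) = rTensor N f.hom.toLinearMap (φ T w)) :
    ∃ x : M ⊗[R] N, ∀ T w, φ T w = rTensor N w x := by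
  let _ : Module Rᵐᵒᵖ M := Module.compHom M ((RingHom.id R).fromOpposite mul_comm)
  have : IsCentralScalar R M := ⟨fun _ _ => rfl⟩
  -- The tensor is the `ε`-part of the value of `φ` at the universal map `M → R ⊕ εM`.
  refine ⟨rTensor N (TrivSqZeroExt.sndHom R M)
    (φ (.of R (TrivSqZeroExt R M)) (TrivSqZeroExt.inrHom R M)), fun T w => ?_⟩
  set y := φ (.of R (TrivSqZeroExt R M)) (TrivSqZeroExt.inrHom R M) with hy
  -- The value `φ(εw)` over the dual numbers `T[ε]` is computed twice: by naturality along `h : R ⊕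
  -- εM → T[ε]`, `εm ↦ εw(m)`, and by homogeneity as `ε • φ(w)`. Comparing `ε`-parts gives the
  -- claim; additivity of `φ` is not needed.
  let D : CommAlgCat.{u} R := .of R (TrivSqZeroExt T T)
  let ι : T →ₐ[R] TrivSqZeroExt T T := TrivSqZeroExt.inlAlgHom R T T
  let σ : TrivSqZeroExt T T →ₗ[R] T := (TrivSqZeroExt.sndHom T T).restrictScalars R
  let ρ : T →ₗ[R] TrivSqZeroExt T T := (TrivSqZeroExt.inrHom T T).restrictScalars R
  let h : TrivSqZeroExt R M →ₐ[R] TrivSqZeroExt T T :=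
    TrivSqZeroExt.liftEquivOfComm ⟨ρ ∘ₗ w, fun _ _ => TrivSqZeroExt.inr_mul_inr _ _ _⟩
  have h1 : φ D (ρ ∘ₗ w) = rTensor N h.toLinearMap y := by
    rw [hy]
    refine Eq.trans ?_ (hnat (T' := D) (CommAlgCat.ofHom h) _)
    congr 1
    ext m : 1
    simp [h]
  have h2 : φ D (ρ ∘ₗ w) =
      (TrivSqZeroExt.inr 1 : TrivSqZeroExt T T) • rTensor N ι.toLinearMap (φ T w) := by
    refine Eq.trans ?_ ((hsmul D _ _).trans (congrArg _
      (hnat (T := T) (T' := D) (CommAlgCat.ofHom ι) w)))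
    congr 1
    ext m : 1
    change TrivSqZeroExt.inr (w m) = TrivSqZeroExt.inr 1 * TrivSqZeroExt.inl (w m)
    rw [TrivSqZeroExt.inr_mul_inl, op_smul_eq_mul, one_mul]
  have h3 : ∀ z : T ⊗[R] N, rTensor N σ
      ((TrivSqZeroExt.inr 1 : TrivSqZeroExt T T) • rTensor N ι.toLinearMap z) = z := by
    intro z
    induction z using TensorProduct.induction_on with
    | zero => simp
    | tmul a b => simp [TensorProduct.smul_tmul', σ, ι]
    | add a b ha hb => simp only [map_add, smul_add, ha, hb]
  have h4 : σ ∘ₗ h.toLinearMap = w ∘ₗ TrivSqZeroExt.sndHom R M := by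
    ext z
    simp [σ, h, ρ, TrivSqZeroExt.lift_def, Algebra.ofId_apply,
      TrivSqZeroExt.algebraMap_eq_inl']
  rw [← h3 (φ T w), ← h2, h1]
  simp only [← LinearMap.comp_apply, ← LinearMap.rTensor_comp, h4]

end Reflexivity

/-! ### The product of a commutative algebra scheme and its comultiplication -/

namespace ModuleSchemeIso

variable {M : Type u} [AddCommGroup M] [Module R M] {𝔸 : CommAlgFunctor R}
  (e : ModuleSchemeIso M 𝔸)

/-- The product of `𝔸(T)`, transported to `Hom(M, T)`. -/
def mul {T : CommAlgCat.{u} R} (w v : M →ₗ[R] T) : M →ₗ[R] T :=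
  (e.equiv T).symm (e.equiv T w * e.equiv T v)

/-- The unit of `𝔸(T)`, transported to `Hom(M, T)`. -/
def one (T : CommAlgCat.{u} R) : M →ₗ[R] T := (e.equiv T).symm 1

@[simp]
theorem equiv_mul {T : CommAlgCat.{u} R} (w v : M →ₗ[R] T) :
    e.equiv T (e.mul w v) = e.equiv T w * e.equiv T v := by
  simp [mul]

@[simp]
theorem equiv_one (T : CommAlgCat.{u} R) : e.equiv T (e.one T) = 1 := by
  simp [one]

theorem comp_mul {T T' : CommAlgCat.{u} R} (f : T ⟶ T') (w v : M →ₗ[R] T) :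
    f.hom.toLinearMap ∘ₗ e.mul w v =
      e.mul (f.hom.toLinearMap ∘ₗ w) (f.hom.toLinearMap ∘ₗ v) := by
  apply (e.equiv T').injective
  simp [e.naturality]

theorem comp_one {T T' : CommAlgCat.{u} R} (f : T ⟶ T') :
    f.hom.toLinearMap ∘ₗ e.one T = e.one T' := by
  apply (e.equiv T').injective
  simp [e.naturality]

theorem smul_mul {T : CommAlgCat.{u} R} (t : T) (w v : M →ₗ[R] T) :
    e.mul (t • w) v = t • e.mul w v := by
  apply (e.equiv T).injective
  simp

theorem mul_smul {T : CommAlgCat.{u} R} (t : T) (w v : M →ₗ[R] T) :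
    e.mul w (t • v) = t • e.mul w v := by
  apply (e.equiv T).injective
  simp

/-- The product of a commutative algebra scheme is given by a comultiplication. -/
theorem exists_comul (c : M) : ∃ d : M ⊗[R] M, ∀ (T : CommAlgCat.{u} R) (w v : M →ₗ[R] T),
    e.mul w v c = LinearMap.mul' R T (TensorProduct.map w v d) := by
  let inl (T' T : CommAlgCat.{u} R) : T' ⟶ .of R (T' ⊗[R] T) :=
    CommAlgCat.ofHom Algebra.TensorProduct.includeLeft
  let inr (T' T : CommAlgCat.{u} R) : T ⟶ .of R (T' ⊗[R] T) :=
    CommAlgCat.ofHom Algebra.TensorProduct.includeRight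
  -- The two factors are placed over independent algebras `T` and `T'`. For fixed `w`, the product
  -- is natural and homogeneous in `v`, hence is contraction with some `x T w`.
  have h1 : ∀ (T : CommAlgCat.{u} R) (w : M →ₗ[R] T), ∃ x : M ⊗[R] T,
      ∀ (T' : CommAlgCat.{u} R) (v : M →ₗ[R] T'),
        (e.mul ((inr T' T).hom.toLinearMap ∘ₗ w) ((inl T' T).hom.toLinearMap ∘ₗ v) c :
          T' ⊗[R] T) = rTensor T v x := by
    intro T w
    refine exists_eq_rTensor (fun T' v => (e.mul ((inr T' T).hom.toLinearMap ∘ₗ w)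
      ((inl T' T).hom.toLinearMap ∘ₗ v) c : T' ⊗[R] T)) ?_ ?_
    · intro T' t v
      have : (inl T' T).hom.toLinearMap ∘ₗ (t • v) =
          (t ⊗ₜ[R] (1 : T) : T' ⊗[R] T) • ((inl T' T).hom.toLinearMap ∘ₗ v) := by
        ext m
        change (t * v m) ⊗ₜ[R] (1 : T) = (t ⊗ₜ[R] (1 : T)) * (v m ⊗ₜ[R] (1 : T))
        simp
      rw [this, mul_smul e (T := .of R (T' ⊗[R] T))]
      change (t ⊗ₜ[R] (1 : T)) * _ = _
      rw [Algebra.smul_def]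
      rfl
    · intro T' T'' f v
      let g : CommAlgCat.of R (T' ⊗[R] T) ⟶ .of R (T'' ⊗[R] T) :=
        CommAlgCat.ofHom (Algebra.TensorProduct.map f.hom (AlgHom.id R T))
      have h := LinearMap.congr_fun (e.comp_mul g ((inr T' T).hom.toLinearMap ∘ₗ w)
        ((inl T' T).hom.toLinearMap ∘ₗ v)) c
      refine Eq.trans ?_ (h.symm.trans ?_)
      · congr 2; ext m; simp [g, inr]
      · rfl
  choose x hx using h1
  have hx_unique : ∀ (T : CommAlgCat.{u} R) (w : M →ₗ[R] T) (y : M ⊗[R] T),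
      (∀ (T' : CommAlgCat.{u} R) (v : M →ₗ[R] T'),
        (e.mul ((inr T' T).hom.toLinearMap ∘ₗ w) ((inl T' T).hom.toLinearMap ∘ₗ v) c :
          T' ⊗[R] T) = rTensor T v y) → x T w = y :=
    fun T w y hy => eq_of_rTensor_eq fun T' v => by rw [← hx, hy]
  -- By uniqueness, `x T w` is itself natural and homogeneous in `w`, so reflexivity applies a
  -- second time.
  obtain ⟨d, hd⟩ := exists_eq_rTensor
    (fun T w => TensorProduct.comm R M T (x T w)) (fun T t w => by
      rw [hx_unique T (t • w) (lTensor M (LinearMap.mulLeft R t) (x T w))]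
      · generalize x T w = y
        induction y using TensorProduct.induction_on with
        | zero => simp
        | tmul a b => simp [TensorProduct.smul_tmul']
        | add a b ha hb => simp only [map_add, smul_add, ha, hb]
      · intro T' v
        have h : (inr T' T).hom.toLinearMap ∘ₗ (t • w) =
            ((1 : T') ⊗ₜ[R] t : T' ⊗[R] T) • ((inr T' T).hom.toLinearMap ∘ₗ w) := by
          ext m
          change (1 : T') ⊗ₜ[R] (t * w m) = ((1 : T') ⊗ₜ[R] t) * ((1 : T') ⊗ₜ[R] w m)
          simp
        rw [h, smul_mul e (T := .of R (T' ⊗[R] T))]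
        change ((1 : T') ⊗ₜ[R] t) * (e.mul ((inr T' T).hom.toLinearMap ∘ₗ w)
          ((inl T' T).hom.toLinearMap ∘ₗ v) c : T' ⊗[R] T) = _
        rw [hx]
        generalize x T w = y
        induction y using TensorProduct.induction_on with
        | zero => simp
        | tmul a b => simp
        | add a b ha hb => simp only [map_add, mul_add, ha, hb])
    (fun {T S} f w => by
      rw [hx_unique S _ (lTensor M f.hom.toLinearMap (x T w))]
      · generalize x T w = y
        induction y using TensorProduct.induction_on with
        | zero => simp
        | tmul a b => simp
        | add a b ha hb => simp only [map_add, ha, hb]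
      · intro T' v
        let g : CommAlgCat.of R (T' ⊗[R] T) ⟶ .of R (T' ⊗[R] S) :=
          CommAlgCat.ofHom (Algebra.TensorProduct.map (AlgHom.id R T') f.hom)
        have h := LinearMap.congr_fun (e.comp_mul g ((inr T' T).hom.toLinearMap ∘ₗ w)
          ((inl T' T).hom.toLinearMap ∘ₗ v)) c
        refine Eq.trans ?_ (h.symm.trans ?_)
        · congr 2; ext m; simp [g, inl]
        · change lTensor T' f.hom.toLinearMap (e.mul ((inr T' T).hom.toLinearMap ∘ₗ w)
            ((inl T' T).hom.toLinearMap ∘ₗ v) c : T' ⊗[R] T) = _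
          rw [hx, ← LinearMap.comp_apply, ← LinearMap.comp_apply,
            LinearMap.lTensor_comp_rTensor, LinearMap.rTensor_comp_lTensor])
  refine ⟨d, fun T w v => ?_⟩
  -- Multiplication `T ⊗ T → T` brings the independent factors back to the same algebra.
  let g : CommAlgCat.of R (T ⊗[R] T) ⟶ T :=
    CommAlgCat.ofHom (Algebra.TensorProduct.lmul' R (S := T))
  have h := LinearMap.congr_fun (e.comp_mul g ((inr T T).hom.toLinearMap ∘ₗ w)
    ((inl T T).hom.toLinearMap ∘ₗ v)) c
  refine Eq.trans ?_ (h.symm.trans ?_)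
  · congr 2 <;> ext m <;> simp [g, inl, inr]
  · change LinearMap.mul' R T (e.mul ((inr T T).hom.toLinearMap ∘ₗ w)
      ((inl T T).hom.toLinearMap ∘ₗ v) c : T ⊗[R] T) = _
    rw [hx, ← (TensorProduct.comm R M T).symm_apply_apply (x T w), hd]
    generalize d = y
    induction y using TensorProduct.induction_on with
    | zero => simp
    | tmul a b => simp [mul_comm]
    | add a b ha hb => simp only [map_add, ha, hb]

end ModuleSchemeIso

/-! ### Points of the spectrum as elements of `M ⊗ S` -/

namespace ModuleSchemeIso

variable {M : Type u} [AddCommGroup M] [Module R M] {𝔸 : CommAlgFunctor R}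
  (e : ModuleSchemeIso M 𝔸) {S S' : CommAlgCat.{u} R}

theorem exists_point (φ : 𝔸.Hom (quasiCoherent S)) : ∃ x : M ⊗[R] S,
    ∀ (T : CommAlgCat.{u} R) (w : M →ₗ[R] T), φ.app T (e.equiv T w) = rTensor S w x :=
  exists_eq_rTensor (fun T w => φ.app T (e.equiv T w))
    (fun T t w => by rw [map_smul]; exact map_smul (φ.app T) t _)
    (fun f w => by rw [e.naturality, φ.naturality]; rfl)

/-- The element of `M ⊗ S` corresponding to an `S`-point of the spectrum of `𝔸`. -/
noncomputable def point (φ : 𝔸.Hom (quasiCoherent S)) : M ⊗[R] S := (e.exists_point φ).choose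

theorem app_equiv (φ : 𝔸.Hom (quasiCoherent S)) (T : CommAlgCat.{u} R) (w : M →ₗ[R] T) :
    φ.app T (e.equiv T w) = rTensor S w (e.point φ) :=
  (e.exists_point φ).choose_spec T w

/-- Contraction with `x` is a morphism of functors of algebras. -/
structure IsPoint (x : M ⊗[R] S) : Prop where
  mul : ∀ (T : CommAlgCat.{u} R) (w v : M →ₗ[R] T),
    rTensor S (e.mul w v) x = (rTensor S w x * rTensor S v x : T ⊗[R] S)
  one : ∀ T : CommAlgCat.{u} R, rTensor S (e.one T) x = (1 : T ⊗[R] S)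

theorem isPoint_point (φ : 𝔸.Hom (quasiCoherent S)) : e.IsPoint (e.point φ) where
  mul T w v := by
    rw [← app_equiv, ← app_equiv, ← app_equiv, equiv_mul]
    exact map_mul (φ.app T) _ _
  one T := by
    rw [← app_equiv, equiv_one]
    exact map_one (φ.app T)

theorem rTensor_add_smul {N : Type u} [AddCommGroup N] [Module R N] {T : CommAlgCat.{u} R}
    (t : T) (w v : M →ₗ[R] T) (x : M ⊗[R] N) :
    rTensor N (t • w + v) x = t • rTensor N w x + rTensor N v x := by
  induction x using TensorProduct.induction_on with
  | zero => simp
  | tmul a b => simp [TensorProduct.smul_tmul']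
  | add a b ha hb => simp only [map_add, ha, hb, smul_add]; abel

/-- The morphism of functors of algebras given by contraction with `x`. -/
noncomputable def ofPoint {x : M ⊗[R] S} (hx : e.IsPoint x) : 𝔸.Hom (quasiCoherent S) where
  app T := AlgHom.ofLinearMap
    { toFun := fun a => (rTensor S ((e.equiv T).symm a) x : T ⊗[R] S)
      map_add' := fun a b => by
        have := rTensor_add_smul (1 : T) ((e.equiv T).symm a) ((e.equiv T).symm b) x
        rw [one_smul, one_smul] at this
        rw [map_add]
        exact this
      map_smul' := fun t a => by
        have := rTensor_add_smul t ((e.equiv T).symm a) 0 x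
        rw [LinearMap.rTensor_zero, LinearMap.zero_apply, add_zero, add_zero] at this
        rw [map_smul]
        exact this }
    (hx.one T) (fun a b => by
      have h := hx.mul T ((e.equiv T).symm a) ((e.equiv T).symm b)
      simp only [mul, LinearEquiv.apply_symm_apply] at h
      exact h)
  naturality {T T'} f a := by
    obtain ⟨w, rfl⟩ := (e.equiv T).surjective a
    rw [← e.naturality]
    change rTensor S _ x = rTensor S f.hom.toLinearMap (rTensor S _ x)
    simp only [LinearEquiv.symm_apply_apply, ← LinearMap.comp_apply, ← LinearMap.rTensor_comp]

theorem ofPoint_app_equiv {x : M ⊗[R] S} (hx : e.IsPoint x) (T : CommAlgCat.{u} R)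
    (w : M →ₗ[R] T) : (e.ofPoint hx).app T (e.equiv T w) = rTensor S w x := by
  change rTensor S ((e.equiv T).symm (e.equiv T w)) x = _
  rw [LinearEquiv.symm_apply_apply]

@[simp]
theorem point_ofPoint {x : M ⊗[R] S} (hx : e.IsPoint x) : e.point (e.ofPoint hx) = x :=
  eq_of_rTensor_eq fun T w => by rw [← app_equiv, ofPoint_app_equiv]

theorem point_injective : Function.Injective (e.point (S := S)) := by
  intro φ ψ h
  ext T a
  obtain ⟨w, rfl⟩ := (e.equiv T).surjective a
  rw [app_equiv, app_equiv, h]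

theorem point_map (g : S ⟶ S') {φ : 𝔸.Hom (quasiCoherent S)} {ψ : 𝔸.Hom (quasiCoherent S')}
    (h : 𝔸.spec.map g φ = ψ) : e.point ψ = lTensor M g.hom.toLinearMap (e.point φ) :=
  eq_of_rTensor_eq fun T w => by
    rw [← app_equiv, ← h]
    change lTensor T g.hom.toLinearMap (φ.app T (e.equiv T w)) = _
    rw [app_equiv, ← LinearMap.comp_apply, ← LinearMap.comp_apply,
      LinearMap.lTensor_comp_rTensor, LinearMap.rTensor_comp_lTensor]

end ModuleSchemeIso

/-- If an element `x` of `A ⊗ S` is grouplike for a map `Δ : A → A ⊗ A`, then contraction with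
`x` carries convolution products of linear maps to products. -/
theorem rTensor_convolution {A S T : Type u} [CommRing A] [Algebra R A] [CommRing S]
    [Algebra R S] [CommRing T] [Algebra R T] (Δ : A →ₗ[R] A ⊗[R] A) {x : A ⊗[R] S}
    (hx : rTensor S Δ x =
      (rTensor S (Algebra.TensorProduct.includeLeft (R := R) (S := R) (A := A)
          (B := A)).toLinearMap x *
        rTensor S (Algebra.TensorProduct.includeRight (R := R) (A := A) (B := A)).toLinearMap x :
        (A ⊗[R] A) ⊗[R] S)) (w v : A →ₗ[R] T) :
    rTensor S (LinearMap.mul' R T ∘ₗ TensorProduct.map w v ∘ₗ Δ) x =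
      (rTensor S w x * rTensor S v x : T ⊗[R] S) := by
  rw [← LinearMap.comp_assoc, LinearMap.rTensor_comp, LinearMap.comp_apply, hx]
  -- The maps `w` and `v` are only linear, but `mul' ∘ (w ⊗ v)` respects products of an element of
  -- the first factor with one of the second. Separating `y` from `z` makes the identity bilinear,
  -- so pure tensors suffice.
  have h : ∀ y z : A ⊗[R] S, rTensor S (LinearMap.mul' R T ∘ₗ TensorProduct.map w v)
      (rTensor S (Algebra.TensorProduct.includeLeft (R := R) (S := R) (A := A)
          (B := A)).toLinearMap y *
        rTensor S (Algebra.TensorProduct.includeRight (R := R) (A := A) (B := A)).toLinearMap z :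
        (A ⊗[R] A) ⊗[R] S) = (rTensor S w y * rTensor S v z : T ⊗[R] S) := by
    intro y z
    induction y using TensorProduct.induction_on with
    | zero => simp
    | add a b ha hb => simp only [map_add, add_mul, ha, hb]
    | tmul a s =>
      induction z using TensorProduct.induction_on with
      | zero => simp
      | add a b ha hb => simp only [map_add, mul_add, ha, hb]
      | tmul b s' => simp
  exact h x x

/-- A presentation of the functor of sets underlying `G` as the spectrum of a commutative
algebra scheme with underlying module scheme `𝓜^*`. -/
structure FormalChart {R : Type u} [CommRing R] (M : Type u) [AddCommGroup M] [Module R M]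
    (G : MonFunctor R) where
  alg : CommAlgFunctor R
  dualIso : ModuleSchemeIso M alg
  iso : G ⋙ forget CommMonCat ≅ alg.spec

namespace FormalChart

variable {M : Type u} [AddCommGroup M] [Module R M] {G : MonFunctor R} (c : FormalChart M G)
  {S S' : CommAlgCat.{u} R}

/-- The element of `M ⊗ S` corresponding to an `S`-point of `G`. -/
noncomputable def pt (g : G.obj S) : M ⊗[R] S := c.dualIso.point (c.iso.hom.app S g)

theorem isPoint_pt (g : G.obj S) : c.dualIso.IsPoint (c.pt g) := c.dualIso.isPoint_point _

theorem pt_map (f : S ⟶ S') (g : G.obj S) :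
    c.pt ((G.map f).hom g) = lTensor M f.hom.toLinearMap (c.pt g) :=
  c.dualIso.point_map f
    (ConcreteCategory.congr_hom (c.iso.hom.naturality f) g).symm

theorem pt_injective : Function.Injective (c.pt (S := S)) :=
  c.dualIso.point_injective.comp (c.iso.app S).toEquiv.injective

theorem exists_pt_eq {x : M ⊗[R] S} (hx : c.dualIso.IsPoint x) : ∃ g : G.obj S, c.pt g = x := by
  obtain ⟨g, hg⟩ := (c.iso.app S).toEquiv.surjective (c.dualIso.ofPoint hx)
  refine ⟨g, ?_⟩
  exact (congrArg c.dualIso.point hg).trans (c.dualIso.point_ofPoint hx)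

end FormalChart

/-! ### Finite-rank endomorphisms of a projective module -/

section Module

variable {M N : Type u} [AddCommGroup M] [Module R M] [AddCommGroup N] [Module R N]

/-- A splitting `s` of the free cover of `M` gives coordinate forms with `m = ∑ s(m)_j • j`.
Truncating this dual basis to the supports of the finitely many `s m` leaves a finite tensor. -/
theorem exists_dualTensorHom_fix [Module.Projective R M] (F : Finset M) :
    ∃ t : Dual R M ⊗[R] M, ∀ m ∈ F, dualTensorHom R M M t m = m := by
  classical
  obtain ⟨s, hs⟩ := Module.projective_def'.mp (inferInstance : Module.Projective R M)
  refine ⟨∑ j ∈ F.biUnion fun m => (s m).support, (Finsupp.lapply j ∘ₗ s) ⊗ₜ j, fun m hm => ?_⟩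
  have h := LinearMap.congr_fun hs m
  rw [LinearMap.comp_apply, Finsupp.linearCombination_apply, LinearMap.id_apply] at h
  rw [map_sum, LinearMap.sum_apply]
  refine Eq.trans ?_ h
  rw [Finsupp.sum_of_support_subset _ (Finset.subset_biUnion_of_mem (fun m => (s m).support) hm)
    _ (by simp)]
  simp [dualTensorHom_apply]

/-- A tensor in `M ⊗ N` involves only finitely many elements of `M`. -/
theorem exists_finset_rTensor_eq (x : M ⊗[R] N) : ∃ F : Finset M,
    ∀ {P : Type u} [AddCommGroup P] [Module R P] (w w' : M →ₗ[R] P),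
      (∀ m ∈ F, w m = w' m) → rTensor N w x = rTensor N w' x := by
  classical
  induction x using TensorProduct.induction_on with
  | zero => exact ⟨∅, by simp⟩
  | tmul a b => exact ⟨{a}, fun w w' h => by simp [h a (by simp)]⟩
  | add a b ha hb =>
    obtain ⟨F, hF⟩ := ha
    obtain ⟨F', hF'⟩ := hb
    refine ⟨F ∪ F', fun w w' h => ?_⟩
    rw [map_add, map_add, hF w w' fun m hm => h m (by simp [hm]),
      hF' w w' fun m hm => h m (by simp [hm])]

theorem exists_finset_map_eq (x : M ⊗[R] M) : ∃ F : Finset M,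
    ∀ {P : Type u} [AddCommGroup P] [Module R P] (w w' v v' : M →ₗ[R] P),
      (∀ m ∈ F, w m = w' m) → (∀ m ∈ F, v m = v' m) →
        TensorProduct.map w v x = TensorProduct.map w' v' x := by
  classical
  induction x using TensorProduct.induction_on with
  | zero => exact ⟨∅, by simp⟩
  | tmul a b => exact ⟨{a, b}, fun w w' v v' h h' => by simp [h a (by simp), h' b (by simp)]⟩
  | add a b ha hb =>
    obtain ⟨F, hF⟩ := ha
    obtain ⟨F', hF'⟩ := hb
    refine ⟨F ∪ F', fun w w' v v' h h' => ?_⟩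
    rw [map_add, map_add,
      hF w w' v v' (fun m hm => h m (by simp [hm])) fun m hm => h' m (by simp [hm]),
      hF' w w' v v' (fun m hm => h m (by simp [hm])) fun m hm => h' m (by simp [hm])]

/-- The contraction of a linear form with the first factor of a tensor. -/
noncomputable def contract {S : Type u} [AddCommGroup S] [Module R S] (x : M ⊗[R] S) :
    Dual R M →ₗ[R] S where
  toFun f := TensorProduct.lid R S (rTensor S f x)
  map_add' f g := by simp [LinearMap.rTensor_add]
  map_smul' a f := by simp [LinearMap.rTensor_smul]

@[simp]
theorem contract_apply {S : Type u} [AddCommGroup S] [Module R S] (x : M ⊗[R] S)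
    (f : Dual R M) : contract x f = TensorProduct.lid R S (rTensor S f x) := rfl

/-- This trades the image of `x` under a finite-rank map for the image of the tensor `t` under
`contract x`: a point fixed by `t` is thereby recovered from its contractions with linear forms. -/
theorem rTensor_dualTensorHom {S : Type u} [AddCommGroup S] [Module R S] (x : M ⊗[R] S)
    (t : Dual R M ⊗[R] N) : rTensor S (dualTensorHom R M N t) x =
      TensorProduct.comm R S N (rTensor N (contract x) t) := by
  induction t using TensorProduct.induction_on with
  | zero => simp
  | add a b ha hb => simp only [map_add, LinearMap.rTensor_add, LinearMap.add_apply, ha, hb]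
  | tmul f n =>
    induction x using TensorProduct.induction_on with
    | zero => simp
    | add a b ha hb =>
      rw [map_add, ha, hb]
      simp [TensorProduct.tmul_add]
    | tmul m s => simp [dualTensorHom_apply, TensorProduct.smul_tmul]

end Module

/-! ### Closed subschemes of points fixed by a finite-rank endomorphism -/

namespace ModuleSchemeIso

variable {M N : Type u} [AddCommGroup M] [Module R M] {𝔸 : CommAlgFunctor R}
  (e : ModuleSchemeIso M 𝔸) [AddCommGroup N] [Module R N] {S : CommAlgCat.{u} R}

theorem add_mul {T : CommAlgCat.{u} R} (w w' v : M →ₗ[R] T) :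
    e.mul (w + w') v = e.mul w v + e.mul w' v := by
  apply (e.equiv T).injective
  simp [_root_.add_mul]

theorem mul_add {T : CommAlgCat.{u} R} (w v v' : M →ₗ[R] T) :
    e.mul w (v + v') = e.mul w v + e.mul w v' := by
  apply (e.equiv T).injective
  simp [_root_.mul_add]

theorem zero_mul {T : CommAlgCat.{u} R} (v : M →ₗ[R] T) : e.mul 0 v = 0 := by
  apply (e.equiv T).injective
  simp

theorem mul_zero {T : CommAlgCat.{u} R} (v : M →ₗ[R] T) : e.mul v 0 = 0 := by
  apply (e.equiv T).injective
  simp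

theorem exists_finset_mul_eq (c : M) : ∃ F : Finset M, ∀ (T : CommAlgCat.{u} R)
    (w w' v v' : M →ₗ[R] T), (∀ m ∈ F, w m = w' m) → (∀ m ∈ F, v m = v' m) →
      e.mul w v c = e.mul w' v' c := by
  obtain ⟨d, hd⟩ := e.exists_comul c
  obtain ⟨F, hF⟩ := exists_finset_map_eq d
  exact ⟨F, fun T w w' v v' h h' => by rw [hd, hd, hF w w' v v' h h']⟩

/-- The value of `𝔸` at `R`. -/
abbrev _root_.FunctorialCartier.CommAlgFunctor.sections (𝔸 : CommAlgFunctor R) : Type u :=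
  𝔸.obj (.of R R)

noncomputable instance (𝔸 : CommAlgFunctor R) : Algebra R 𝔸.sections := 𝔸.algebra (.of R R)

/-- Linear forms on `M` as elements of `𝔸(R)`. -/
noncomputable def dualEquiv : Dual R M ≃ₗ[R] 𝔸.sections := e.equiv (.of R R)

/-- The ideal defining the closed subscheme of points fixed by the endomorphism of finite rank
associated with `t`. -/
noncomputable def fixIdeal (t : Dual R M ⊗[R] M) : Ideal 𝔸.sections :=
  Ideal.span (Set.range fun f : Dual R M =>
    e.dualEquiv f - e.dualEquiv (f ∘ₗ dualTensorHom R M M t))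

/-- The algebra of the closed subscheme of points fixed by the endomorphism of finite rank
associated with `t`. -/
noncomputable abbrev fixAlg (t : Dual R M ⊗[R] M) : Type u := 𝔸.sections ⧸ e.fixIdeal t

/-- The class of a linear form. -/
noncomputable def cls (t : Dual R M ⊗[R] M) : Dual R M →ₗ[R] e.fixAlg t :=
  (Ideal.Quotient.mkₐ R (e.fixIdeal t)).toLinearMap ∘ₗ e.dualEquiv.toLinearMap

theorem cls_surjective (t : Dual R M ⊗[R] M) : Function.Surjective (e.cls t) :=
  (Ideal.Quotient.mkₐ_surjective R _).comp e.dualEquiv.surjective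

theorem cls_comp (t : Dual R M ⊗[R] M) (f : Dual R M) :
    e.cls t (f ∘ₗ dualTensorHom R M M t) = e.cls t f :=
  ((Ideal.Quotient.mk_eq_mk_iff_sub_mem (I := e.fixIdeal t) (e.dualEquiv f) _).mpr
    (Ideal.subset_span (Set.mem_range_self f))).symm

theorem cls_mul (t : Dual R M ⊗[R] M) (f g : Dual R M) :
    e.cls t (e.mul (T := .of R R) f g) = e.cls t f * e.cls t g := by
  have h : e.dualEquiv (e.mul (T := .of R R) f g) = e.dualEquiv f * e.dualEquiv g :=
    e.equiv_mul _ _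
  simp only [cls, LinearMap.comp_apply, LinearEquiv.coe_coe, h]
  exact map_mul (Ideal.Quotient.mkₐ R (e.fixIdeal t)) _ _

theorem cls_one (t : Dual R M ⊗[R] M) : e.cls t (e.one (.of R R)) = 1 := by
  have h : e.dualEquiv (e.one (.of R R)) = 1 := e.equiv_one _
  simp only [cls, LinearMap.comp_apply, LinearEquiv.coe_coe, h]
  exact map_one (Ideal.Quotient.mkₐ R (e.fixIdeal t))

/-- The universal point fixed by the endomorphism of finite rank associated with `t`. -/
noncomputable def univ (t : Dual R M ⊗[R] M) : M ⊗[R] e.fixAlg t :=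
  TensorProduct.comm R _ M (rTensor M (e.cls t) t)

/-- For `t = ∑ gᵢ ⊗ mᵢ`, contracting `f` with `∑ mᵢ ⊗ [gᵢ]` gives `∑ f(mᵢ)[gᵢ] = [f ∘ t]`, and this
is `[f]` in the quotient. -/
theorem contract_univ (t : Dual R M ⊗[R] M) : contract (e.univ t) = e.cls t := by
  ext f
  rw [← e.cls_comp t f, univ]
  have h : ∀ y : Dual R M ⊗[R] M,
      contract (TensorProduct.comm R _ M (rTensor M (e.cls t) y)) f =
        e.cls t (f ∘ₗ dualTensorHom R M M y) := by
    intro y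
    induction y using TensorProduct.induction_on with
    | zero => simp
    | add a b ha hb =>
      simp only [contract_apply, map_add, LinearMap.comp_add] at ha hb ⊢
      rw [ha, hb]
    | tmul g m =>
      have : f ∘ₗ dualTensorHom R M M (g ⊗ₜ m) = f m • g := by
        ext x
        simp [dualTensorHom_apply, mul_comm]
      rw [this]
      simp
  exact h t

/-- A linear form, with values in a commutative algebra. -/
noncomputable def _root_.FunctorialCartier.baseChangeForm (T : CommAlgCat.{u} R)
    (f : Dual R M) : M →ₗ[R] T := Algebra.linearMap R T ∘ₗ f

theorem mul_baseChangeForm (T : CommAlgCat.{u} R) (f g : Dual R M) :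
    e.mul (baseChangeForm T f) (baseChangeForm T g) =
      baseChangeForm T (e.mul (T := .of R R) f g) :=
  (e.comp_mul (T := .of R R) (T' := T) (CommAlgCat.ofHom (Algebra.ofId R T)) f g).symm

theorem one_eq_baseChangeForm (T : CommAlgCat.{u} R) :
    e.one T = baseChangeForm T (e.one (.of R R)) :=
  (e.comp_one (T := .of R R) (T' := T) (CommAlgCat.ofHom (Algebra.ofId R T))).symm

theorem _root_.FunctorialCartier.rTensor_baseChangeForm (T S : CommAlgCat.{u} R) (f : Dual R M)
    (x : M ⊗[R] S) :
    rTensor S (baseChangeForm T f) x = (1 : T) ⊗ₜ[R] contract x f := by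
  induction x using TensorProduct.induction_on with
  | zero => simp
  | add a b ha hb =>
    simp only [contract_apply, map_add, TensorProduct.tmul_add] at ha hb ⊢
    rw [ha, hb]
  | tmul m s =>
    simp [baseChangeForm, Algebra.algebraMap_eq_smul_one, TensorProduct.smul_tmul]

/-- On scalar forms the claim is multiplicativity of `cls`. It extends `T`-bilinearly to maps of
finite rank, and then to all maps, since only finitely many of their values matter. -/
theorem isPoint_univ [Module.Projective R M] (t : Dual R M ⊗[R] M) :
    e.IsPoint (S := .of R (e.fixAlg t)) (e.univ t) where
  one T := by
    rw [one_eq_baseChangeForm]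
    refine (rTensor_baseChangeForm T (.of R (e.fixAlg t)) _ _).trans ?_
    rw [contract_univ, cls_one]
    rfl
  mul T w v := by
    classical
    have key : ∀ s s' : Dual R M ⊗[R] M,
        rTensor (e.fixAlg t) (e.mul (w ∘ₗ dualTensorHom R M M s) (v ∘ₗ dualTensorHom R M M s'))
            (e.univ t) =
          (rTensor (e.fixAlg t) (w ∘ₗ dualTensorHom R M M s) (e.univ t) *
            rTensor (e.fixAlg t) (v ∘ₗ dualTensorHom R M M s') (e.univ t) :
              T ⊗[R] e.fixAlg t) := by
      have hw : ∀ (w : M →ₗ[R] T) (f : Dual R M) (m : M),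
          w ∘ₗ dualTensorHom R M M (f ⊗ₜ m) = w m • baseChangeForm T f := by
        intro w f m
        ext x
        simp [dualTensorHom_apply, baseChangeForm, Algebra.smul_def, mul_comm]
      have hr : ∀ (a : T) (f : Dual R M),
          rTensor (e.fixAlg t) (a • baseChangeForm T f) (e.univ t) = a ⊗ₜ[R] e.cls t f := by
        intro a f
        have h1 := rTensor_add_smul a (baseChangeForm T f) 0 (e.univ t)
        have h2 := rTensor_baseChangeForm T (.of R (e.fixAlg t)) f (e.univ t)
        rw [contract_univ] at h2
        rw [add_zero, LinearMap.rTensor_zero, LinearMap.zero_apply, add_zero] at h1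
        rw [h1]
        refine (congrArg (a • ·) h2).trans ?_
        simp [TensorProduct.smul_tmul']
      intro s s'
      induction s using TensorProduct.induction_on with
      | zero => simp [e.zero_mul]
      | add a b ha hb =>
        simp only [map_add, LinearMap.comp_add, e.add_mul, LinearMap.rTensor_add,
          LinearMap.add_apply, ha, hb, _root_.add_mul]
      | tmul f m =>
        induction s' using TensorProduct.induction_on with
        | zero => simp [e.mul_zero]
        | add a b ha hb =>
          simp only [map_add, LinearMap.comp_add, e.mul_add, LinearMap.rTensor_add,
            LinearMap.add_apply, ha, hb, _root_.mul_add]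
        | tmul g n =>
          rw [hw, hw, e.smul_mul, e.mul_smul, mul_baseChangeForm, smul_smul, hr, hr, hr, cls_mul,
            Algebra.TensorProduct.tmul_mul_tmul]
    obtain ⟨F, hF⟩ := exists_finset_rTensor_eq (e.univ t)
    choose F' hF' using e.exists_finset_mul_eq
    -- `F` controls the contractions with `univ t`; `F' c` controls the value at `c` of a product.
    obtain ⟨s, hs⟩ := exists_dualTensorHom_fix (R := R) (F ∪ F.biUnion F')
    have h := key s s
    rw [hF (w ∘ₗ dualTensorHom R M M s) w, hF (v ∘ₗ dualTensorHom R M M s) v, hF _ (e.mul w v)] at h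
    · exact h
    · intro c hc
      apply hF' c <;>
      · intro m hm
        have : m ∈ F.biUnion F' := Finset.mem_biUnion.mpr ⟨c, hc, hm⟩
        simp [hs m (Finset.mem_union_right _ this)]
    · intro c hc
      simp [hs c (Finset.mem_union_left _ hc)]
    · intro c hc
      simp [hs c (Finset.mem_union_left _ hc)]

/-- A point fixed by the endomorphism of finite rank associated with `t` is a specialization of
the universal one. -/
theorem exists_algHom_fixAlg (t : Dual R M ⊗[R] M) {x : M ⊗[R] S} (hx : e.IsPoint x)
    (ht : rTensor S (dualTensorHom R M M t) x = x) :
    ∃ h : e.fixAlg t →ₐ[R] S, (∀ f, h (e.cls t f) = contract x f) ∧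
      lTensor M h.toLinearMap (e.univ t) = x := by
  -- The component at `R` of the morphism given by `x` sends a form to its contraction with `x`; it
  -- kills `f - f ∘ t` because `t` fixes `x`.
  let h0 : 𝔸.sections →ₐ[R] S := (Algebra.TensorProduct.lid R S).toAlgHom.comp
    ((e.ofPoint hx).app (.of R R) : 𝔸.sections →ₐ[R] R ⊗[R] S)
  have h0_apply : ∀ f : Dual R M, h0 (e.dualEquiv f) = contract x f := fun f =>
    congrArg (TensorProduct.lid R S) (e.ofPoint_app_equiv hx (.of R R) f)
  have hker : ∀ a ∈ e.fixIdeal t, h0 a = 0 := by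
    intro a ha
    have : e.fixIdeal t ≤ RingHom.ker h0 := by
      rw [fixIdeal, Ideal.span_le]
      rintro _ ⟨f, rfl⟩
      rw [SetLike.mem_coe, RingHom.mem_ker, map_sub, h0_apply, h0_apply, contract_apply,
        contract_apply, LinearMap.rTensor_comp, LinearMap.comp_apply, ht, sub_self]
    exact this ha
  let h := Ideal.Quotient.liftₐ (e.fixIdeal t) h0 hker
  have h_apply : ∀ f, h (e.cls t f) = contract x f := fun f => by
    rw [← h0_apply f]
    exact Ideal.Quotient.liftₐ_apply (e.fixIdeal t) h0 hker (Ideal.Quotient.mk _ (e.dualEquiv f))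
  refine ⟨h, h_apply, ?_⟩
  conv_rhs => rw [← ht, rTensor_dualTensorHom]
  have : contract x = h.toLinearMap ∘ₗ e.cls t := by
    ext f
    exact (h_apply f).symm
  rw [this, LinearMap.rTensor_comp, LinearMap.comp_apply, univ]
  generalize rTensor M (e.cls t) t = y
  induction y using TensorProduct.induction_on with
  | zero => simp
  | add a b ha hb => simp only [map_add, ha, hb]
  | tmul a m => simp

/-- Evaluation of linear forms at `c` descends to `fixAlg t` for `t` large enough. -/
theorem exists_eval (c : M) : ∃ F : Finset M, ∀ t : Dual R M ⊗[R] M,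
    (∀ m ∈ F, dualTensorHom R M M t m = m) →
      ∃ l : e.fixAlg t →ₗ[R] R, (∀ f, l (e.cls t f) = f c) ∧
        TensorProduct.rid R M (lTensor M l (e.univ t)) = c := by
  classical
  obtain ⟨F, hF⟩ := e.exists_finset_mul_eq c
  -- Fixing `F` makes evaluation at `c` descend to the quotient; fixing `c` itself gives the last
  -- equality.
  refine ⟨insert c F, fun t ht => ?_⟩
  let l0 : 𝔸.sections →ₗ[R] R := LinearMap.applyₗ c ∘ₗ e.dualEquiv.symm.toLinearMap
  have hl0 : (e.fixIdeal t).restrictScalars R ≤ LinearMap.ker l0 := by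
    intro a ha
    -- The claim covers all multiples of `a`, so that it passes through the induction on the ideal.
    -- On generators, the forms `f` and `f ∘ t` agree on `F`, so their products with `g` agree at
    -- `c`.
    have h : ∀ b, l0 (b * a) = 0 := by
      refine Submodule.span_induction (p := fun a _ => ∀ b, l0 (b * a) = 0) ?_ ?_ ?_ ?_ ha
      · rintro _ ⟨f, rfl⟩ b
        obtain ⟨g, rfl⟩ := e.dualEquiv.surjective b
        have h1 : ∀ f, e.dualEquiv g * e.dualEquiv f =
            e.dualEquiv (e.mul (T := .of R R) g f) := fun f => (e.equiv_mul _ _).symm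
        rw [_root_.mul_sub, h1, h1, map_sub, sub_eq_zero]
        simp only [l0, LinearMap.comp_apply, LinearEquiv.coe_coe, LinearEquiv.symm_apply_apply,
          LinearMap.applyₗ_apply_apply]
        refine hF (.of R R) g g f _ (fun _ _ => rfl) fun m hm => ?_
        simp [ht m (Finset.mem_insert_of_mem hm)]
      · simp
      · intro x y _ _ hx hy b
        rw [_root_.mul_add, map_add, hx, hy, add_zero]
      · intro a x _ hx b
        rw [smul_eq_mul, ← mul_assoc, hx]
    simpa using h 1
  let l : e.fixAlg t →ₗ[R] R := Submodule.liftQ ((e.fixIdeal t).restrictScalars R) l0 hl0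
  have hl : ∀ f, l (e.cls t f) = f c := fun f => by
    change l0 (e.dualEquiv f) = f c
    simp [l0]
  refine ⟨l, hl, ?_⟩
  conv_rhs => rw [← ht c (Finset.mem_insert_self c F)]
  have : l ∘ₗ e.cls t = LinearMap.applyₗ c := by
    ext f
    exact hl f
  have h2 : lTensor M l (e.univ t) =
      TensorProduct.comm R _ M (rTensor M (LinearMap.applyₗ c) t) := by
    rw [← this, LinearMap.rTensor_comp, LinearMap.comp_apply, univ]
    generalize rTensor M (e.cls t) t = y
    induction y using TensorProduct.induction_on with
    | zero => simp
    | add a b ha hb => simp only [map_add, ha, hb]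
    | tmul a m => simp
  rw [h2]
  generalize t = y
  induction y using TensorProduct.induction_on with
  | zero => simp
  | add a b ha hb => simp only [map_add, ha, hb, LinearMap.add_apply]
  | tmul a m => simp [dualTensorHom_apply]

end ModuleSchemeIso

/-! ### Linearity of natural maps out of a formal monoid -/

namespace FormalChart

variable {M N : Type u} [AddCommGroup M] [Module R M] [AddCommGroup N] [Module R N]
  {G : MonFunctor R} (C : FormalChart M G)

/-- The points of a formal monoid span the underlying module. -/
theorem exists_rid_lTensor_pt [Module.Projective R M] (m : M) :
    ∃ (T : CommAlgCat.{u} R) (g : G.obj T) (l : T →ₗ[R] R),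
      TensorProduct.rid R M (lTensor M l (C.pt g)) = m := by
  obtain ⟨F, hF⟩ := C.dualIso.exists_eval m
  obtain ⟨t, ht⟩ := exists_dualTensorHom_fix (R := R) F
  obtain ⟨l, -, hl⟩ := hF t ht
  obtain ⟨g, hg⟩ := C.exists_pt_eq (C.dualIso.isPoint_univ t)
  exact ⟨_, g, l, by rw [hg]; exact hl⟩

/-- A formal monoid is a filtered union of the closed subschemes of points fixed by endomorphisms
of finite rank. -/
theorem exists_exhaustion [Module.Projective R M] :
    ∃ (Q : Dual R M ⊗[R] M → CommAlgCat.{u} R) (cls : ∀ t, Dual R M →ₗ[R] Q t)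
      (U : ∀ t, G.obj (Q t)),
      (∀ t, Function.Surjective (cls t)) ∧ (∀ t, contract (C.pt (U t)) = cls t) ∧
      (∀ (S : CommAlgCat.{u} R) (g : G.obj S), ∃ F : Finset M,
        ∀ t : Dual R M ⊗[R] M, (∀ m ∈ F, dualTensorHom R M M t m = m) →
          ∃ h : Q t ⟶ S, (∀ f, h.hom (cls t f) = contract (C.pt g) f) ∧
            (G.map h).hom (U t) = g) ∧
      ∀ m : M, ∃ F : Finset M, ∀ t : Dual R M ⊗[R] M,
        (∀ m ∈ F, dualTensorHom R M M t m = m) →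
          ∃ l : Q t →ₗ[R] R, ∀ f, l (cls t f) = f m := by
  let e := C.dualIso
  choose U hU using fun t =>
    C.exists_pt_eq (S := .of R (e.fixAlg t)) (C.dualIso.isPoint_univ t)
  refine ⟨fun t => .of R (e.fixAlg t), e.cls, U, e.cls_surjective,
    fun t => (congrArg contract (hU t)).trans (e.contract_univ t), ?_, ?_⟩
  · intro S g
    obtain ⟨F, hF⟩ := exists_finset_rTensor_eq (C.pt g)
    refine ⟨F, fun t ht => ?_⟩
    obtain ⟨h, hh, hx⟩ := e.exists_algHom_fixAlg t (C.isPoint_pt g) (by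
      rw [hF _ LinearMap.id ht, LinearMap.rTensor_id, LinearMap.id_apply])
    refine ⟨CommAlgCat.ofHom h, hh, C.pt_injective ?_⟩
    rw [C.pt_map, hU]
    exact hx
  · intro m
    obtain ⟨F, hF⟩ := e.exists_eval m
    refine ⟨F, fun t ht => ?_⟩
    obtain ⟨l, hl, -⟩ := hF t ht
    exact ⟨l, hl⟩

/-- Every natural map from a formal monoid to a quasi-coherent module is linear. -/
theorem exists_eq_rTensor_pt [Module.Projective R M]
    (Φ : ∀ S : CommAlgCat.{u} R, G.obj S → N ⊗[R] S)
    (hΦ : ∀ {S S' : CommAlgCat.{u} R} (f : S ⟶ S') (g : G.obj S),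
      Φ S' ((G.map f).hom g) = lTensor N f.hom.toLinearMap (Φ S g)) :
    ∃ w : M →ₗ[R] N, ∀ (S : CommAlgCat.{u} R) (g : G.obj S), Φ S g = rTensor S w (C.pt g) := by
  classical
  obtain ⟨Q, cls, U, cls_surjective, hU, support, hF⟩ := C.exists_exhaustion
  choose F hF using hF
  have cls_ext : ∀ (t : Dual R M ⊗[R] M) {P : Type u} [AddCommGroup P] [Module R P]
      (a b : Q t →ₗ[R] P), (∀ f, a (cls t f) = b (cls t f)) → a = b := by
    intro t P _ _ a b h
    ext y
    obtain ⟨f, rfl⟩ := cls_surjective t y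
    exact h f
  -- The value at `m` is to be `Φ` at a universal point, followed by evaluation at `m`. It does not
  -- depend on `t`: any two universal points are specializations of a third, compatibly with the
  -- evaluations.
  have value_unique : ∀ (m : M) (t t' : Dual R M ⊗[R] M) (l : Q t →ₗ[R] R)
      (l' : Q t' →ₗ[R] R), (∀ f, l (cls t f) = f m) → (∀ f, l' (cls t' f) = f m) →
      lTensor N l (Φ (Q t) (U t)) = lTensor N l' (Φ (Q t') (U t')) := by
    intro m t t' l l' hl hl'
    obtain ⟨F₁, h₁⟩ := support _ (U t)
    obtain ⟨F₂, h₂⟩ := support _ (U t')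
    obtain ⟨s, hs⟩ := exists_dualTensorHom_fix (R := R) (F m ∪ F₁ ∪ F₂)
    obtain ⟨k, hk⟩ := hF m s fun n hn => hs n (by simp [hn])
    have aux : ∀ (t : Dual R M ⊗[R] M) (l : Q t →ₗ[R] R) (h : Q s ⟶ Q t),
        (∀ f, l (cls t f) = f m) → (∀ f, h.hom (cls s f) = contract (C.pt (U t)) f) →
        (G.map h).hom (U s) = U t →
        lTensor N l (Φ (Q t) (U t)) = lTensor N k (Φ (Q s) (U s)) := by
      intro t l h hl hh hU'
      rw [← hU', hΦ]
      have : k = l ∘ₗ h.hom.toLinearMap := by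
        apply cls_ext
        intro f
        rw [hk]
        refine (hl f).symm.trans (congrArg l ?_)
        refine Eq.trans ?_ (hh f).symm
        rw [hU]
      rw [this, LinearMap.lTensor_comp]
      rfl
    obtain ⟨h, hh, hhU⟩ := h₁ s fun n hn => hs n (by simp [hn])
    obtain ⟨h', hh', hhU'⟩ := h₂ s fun n hn => hs n (by simp [hn])
    rw [aux t l h hl hh hhU, aux t' l' h' hl' hh' hhU']
  choose τ hτ using fun m => exists_dualTensorHom_fix (R := R) (F m)
  choose l hl using fun m => hF m (τ m) (hτ m)
  let w : M →ₗ[R] N :=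
    { toFun := fun m => TensorProduct.rid R N (lTensor N (l m) (Φ _ (U (τ m))))
      map_add' := fun m n => by
        obtain ⟨s, hs⟩ := exists_dualTensorHom_fix (R := R) (F m ∪ F n)
        obtain ⟨k, hk⟩ := hF m s fun n hn => hs n (by simp [hn])
        obtain ⟨k', hk'⟩ := hF n s fun n hn => hs n (by simp [hn])
        rw [value_unique m _ s (l m) k (hl m) hk, value_unique n _ s (l n) k' (hl n) hk',
          value_unique (m + n) _ s (l (m + n)) (k + k') (hl _) (fun f => by simp [hk, hk']),
          LinearMap.lTensor_add, LinearMap.add_apply, map_add]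
      map_smul' := fun a m => by
        rw [value_unique (a • m) _ (τ m) (l (a • m)) (a • l m) (hl _) (fun f => by simp [hl]),
          LinearMap.lTensor_smul, LinearMap.smul_apply, map_smul, RingHom.id_apply] }
  have hw : ∀ (m : M) (t : Dual R M ⊗[R] M) (k : Q t →ₗ[R] R),
      (∀ f, k (cls t f) = f m) → w m = TensorProduct.rid R N (lTensor N k (Φ _ (U t))) :=
    fun m t k hk => congrArg _ (value_unique m _ t (l m) k (hl m) hk)
  refine ⟨w, fun S g => ?_⟩
  obtain ⟨F₁, h₁⟩ := support S g
  obtain ⟨F₂, h₂⟩ := exists_finset_rTensor_eq (C.pt g)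
  obtain ⟨t, ht⟩ := exists_dualTensorHom_fix (R := R) (F₁ ∪ F₂.biUnion F)
  obtain ⟨h, hh, hhU⟩ := h₁ t fun n hn => ht n (by simp [hn])
  -- Lifting `Φ` of the universal point to `Dual R M ⊗ N` yields a finite-rank map that agrees with
  -- `w` on the elements occurring in `C.pt g`; `rTensor_dualTensorHom` then evaluates it at this
  -- point.
  obtain ⟨y, hy⟩ := LinearMap.rTensor_surjective N (cls_surjective t)
    (TensorProduct.comm R N (Q t) (Φ (Q t) (U t)))
  have hy' : Φ (Q t) (U t) = lTensor N (cls t) (TensorProduct.comm R _ N y) := by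
    rw [← (TensorProduct.comm R N (Q t)).symm_apply_apply (Φ (Q t) (U t)), ← hy]
    generalize y = y
    induction y using TensorProduct.induction_on with
    | zero => simp
    | add a b ha hb => simp only [map_add, ha, hb]
    | tmul a m => simp
  have hwy : ∀ m ∈ F₂, w m = dualTensorHom R M N y m := by
    intro m hm
    obtain ⟨k, hk⟩ := hF m t fun n hn =>
      ht n (Finset.mem_union_right _ (Finset.mem_biUnion.mpr ⟨m, hm, hn⟩))
    have hk' : k ∘ₗ cls t = LinearMap.applyₗ m := by
      ext f
      exact hk f
    rw [hw m t k hk, hy', ← LinearMap.comp_apply (lTensor N k), ← LinearMap.lTensor_comp, hk']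
    generalize y = y
    induction y using TensorProduct.induction_on with
    | zero => simp
    | add a b ha hb => simp only [map_add, ha, hb, LinearMap.add_apply]
    | tmul a m => simp [dualTensorHom_apply]
  have hh' : contract (C.pt g) = h.hom.toLinearMap ∘ₗ cls t := by
    ext f
    exact (hh f).symm
  rw [h₂ _ _ hwy, rTensor_dualTensorHom, ← hhU, hΦ, hy', hhU, hh']
  generalize y = y
  induction y using TensorProduct.induction_on with
  | zero => simp
  | add a b ha hb => simp only [map_add, ha, hb]
  | tmul a m => simp

/-- Every element of `M` is obtained from a point by applying some `l : T → R` to the coefficients,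
and this operation commutes with linear maps out of `M`. -/
theorem linearMap_ext [Module.Projective R M] {w v : M →ₗ[R] N}
    (h : ∀ (S : CommAlgCat.{u} R) (g : G.obj S), rTensor S w (C.pt g) = rTensor S v (C.pt g)) :
    w = v := by
  ext m
  obtain ⟨T, g, l, rfl⟩ := C.exists_rid_lTensor_pt m
  have h1 : ∀ (w : M →ₗ[R] N) (x : M ⊗[R] T), w (TensorProduct.rid R M (lTensor M l x)) =
      TensorProduct.rid R N (lTensor N l (rTensor T w x)) := by
    intro w x
    induction x using TensorProduct.induction_on with
    | zero => simp
    | add a b ha hb => simp only [map_add, ha, hb]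
    | tmul a m => simp
  rw [h1, h1, h T g]

end FormalChart

/-! ### Bilinear extension and the algebra structure on `M` -/

namespace FormalChart

variable {M N : Type u} [AddCommGroup M] [Module R M] [AddCommGroup N] [Module R N]
  {G : MonFunctor R} (C : FormalChart M G)

/-- The base change of a bilinear map. -/
noncomputable abbrev _root_.FunctorialCartier.bilinBaseChange (b : M →ₗ[R] M →ₗ[R] N)
    (S : Type u) [CommRing S] [Algebra R S] : M ⊗[R] S →ₗ[R] M ⊗[R] S →ₗ[R] N ⊗[R] S :=
  TensorProduct.map₂ b (LinearMap.mul R S)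

/-- Every natural map from the square of a formal monoid to a quasi-coherent module is
bilinear. -/
theorem exists_eq_bilinBaseChange [Module.Projective R M]
    (Ψ : ∀ S : CommAlgCat.{u} R, G.obj S → G.obj S → N ⊗[R] S)
    (hΨ : ∀ {S S' : CommAlgCat.{u} R} (f : S ⟶ S') (g h : G.obj S),
      Ψ S' ((G.map f).hom g) ((G.map f).hom h) = lTensor N f.hom.toLinearMap (Ψ S g h)) :
    ∃ b : M →ₗ[R] M →ₗ[R] N, ∀ (S : CommAlgCat.{u} R) (g h : G.obj S),
      Ψ S g h = bilinBaseChange b S (C.pt g) (C.pt h) := by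
  let inl (T' T : CommAlgCat.{u} R) : T' ⟶ .of R (T' ⊗[R] T) :=
    CommAlgCat.ofHom Algebra.TensorProduct.includeLeft
  let inr (T' T : CommAlgCat.{u} R) : T ⟶ .of R (T' ⊗[R] T) :=
    CommAlgCat.ofHom Algebra.TensorProduct.includeRight
  let κ (T' T : CommAlgCat.{u} R) : N ⊗[R] (T' ⊗[R] T) ≃ₗ[R] (N ⊗[R] T) ⊗[R] T' :=
    (TensorProduct.assoc R N T' T).symm ≪≫ₗ TensorProduct.rightComm R N T' T
  -- With the two points over independent algebras, the value is natural in `g` for fixed `h`, hence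
  -- linear in it.
  have h1 : ∀ (T : CommAlgCat.{u} R) (h : G.obj T), ∃ w : M →ₗ[R] N ⊗[R] T,
      ∀ (T' : CommAlgCat.{u} R) (g : G.obj T'),
        κ T' T (Ψ (.of R (T' ⊗[R] T)) ((G.map (inl T' T)).hom g) ((G.map (inr T' T)).hom h)) =
          rTensor T' w (C.pt g) := by
    intro T h
    refine C.exists_eq_rTensor_pt (fun T' g => κ T' T (Ψ (.of R (T' ⊗[R] T))
      ((G.map (inl T' T)).hom g) ((G.map (inr T' T)).hom h))) ?_
    intro T' T'' f g
    let k : CommAlgCat.of R (T' ⊗[R] T) ⟶ .of R (T'' ⊗[R] T) :=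
      CommAlgCat.ofHom (Algebra.TensorProduct.map f.hom (AlgHom.id R T))
    have hl : f ≫ inl T'' T = inl T' T ≫ k := by
      ext x
      simp [inl, k]
    have hr : inr T'' T = inr T' T ≫ k := by
      ext x
      simp [inr, k]
    have h2 := hΨ k ((G.map (inl T' T)).hom g) ((G.map (inr T' T)).hom h)
    simp only [← CommMonCat.comp_apply, ← G.map_comp, ← hl, ← hr] at h2
    simp only [← CommMonCat.comp_apply, ← G.map_comp]
    rw [h2]
    generalize Ψ _ _ _ = y
    change N ⊗[R] (T' ⊗[R] T) at y
    induction y using TensorProduct.induction_on with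
    | zero => simp
    | add a b ha hb => simp only [map_add, ha, hb]
    | tmul n z =>
      induction z using TensorProduct.induction_on with
      | zero => simp
      | add a b ha hb => simp only [map_add, TensorProduct.tmul_add, ha, hb]
      | tmul a b => simp [κ, k]
  choose w hw using h1
  have w_map : ∀ {T S : CommAlgCat.{u} R} (f : T ⟶ S) (h : G.obj T),
      w S ((G.map f).hom h) = lTensor N f.hom.toLinearMap ∘ₗ w T h := by
    intro T S f h
    refine C.linearMap_ext fun T' g => ?_
    let k : CommAlgCat.of R (T' ⊗[R] T) ⟶ .of R (T' ⊗[R] S) :=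
      CommAlgCat.ofHom (Algebra.TensorProduct.map (AlgHom.id R T') f.hom)
    have hl : inl T' S = inl T' T ≫ k := by
      ext x
      simp [inl, k]
    have hr : f ≫ inr T' S = inr T' T ≫ k := by
      ext x
      simp [inr, k]
    have h2 := hΨ k ((G.map (inl T' T)).hom g) ((G.map (inr T' T)).hom h)
    simp only [← CommMonCat.comp_apply, ← G.map_comp, ← hl, ← hr] at h2
    rw [← hw, LinearMap.rTensor_comp, LinearMap.comp_apply, ← hw]
    simp only [← CommMonCat.comp_apply, ← G.map_comp]
    rw [h2]
    generalize Ψ _ _ _ = y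
    change N ⊗[R] (T' ⊗[R] T) at y
    induction y using TensorProduct.induction_on with
    | zero => simp
    | add a b ha hb => simp only [map_add, ha, hb]
    | tmul n z =>
      induction z using TensorProduct.induction_on with
      | zero => simp
      | add a b ha hb => simp only [map_add, TensorProduct.tmul_add, ha, hb]
      | tmul a b => simp [κ, k]
  -- For fixed `m`, the value `w T h m` is natural in `h`, so the linear case applies again.
  choose b hb using fun m => C.exists_eq_rTensor_pt (fun T h => w T h m)
    (fun f h => LinearMap.congr_fun (w_map f h) m)
  let B : M →ₗ[R] M →ₗ[R] N :=
    { toFun := b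
      map_add' := fun m n => C.linearMap_ext fun S g => by
        rw [LinearMap.rTensor_add, LinearMap.add_apply, ← hb, ← hb, ← hb, map_add]
      map_smul' := fun a m => C.linearMap_ext fun S g => by
        rw [LinearMap.rTensor_smul, LinearMap.smul_apply, ← hb, ← hb, map_smul,
          RingHom.id_apply] }
  refine ⟨B, fun S g h => ?_⟩
  -- Two points over the same `S` are recovered through `S ⊗ S → S`.
  let k : CommAlgCat.of R (S ⊗[R] S) ⟶ S :=
    CommAlgCat.ofHom (Algebra.TensorProduct.lmul' R (S := S))
  have hl : inl S S ≫ k = 𝟙 S := by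
    ext x
    simp [inl, k]
  have hr : inr S S ≫ k = 𝟙 S := by
    ext x
    simp [inr, k]
  have h2 := hΨ k ((G.map (inl S S)).hom g) ((G.map (inr S S)).hom h)
  simp only [← CommMonCat.comp_apply, ← G.map_comp, hl, hr, G.map_id, CommMonCat.id_apply] at h2
  rw [h2, ← (κ S S).symm_apply_apply
    (Ψ _ ((G.map (inl S S)).hom g) ((G.map (inr S S)).hom h)), hw]
  have key : ∀ (x y : M ⊗[R] S) (v : M →ₗ[R] N ⊗[R] S), (∀ m, v m = rTensor S (B m) y) →
      lTensor N k.hom.toLinearMap ((κ S S).symm (rTensor S v x)) = bilinBaseChange B S x y := by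
    intro x y v hv
    induction x using TensorProduct.induction_on with
    | zero => simp
    | add a b ha hb => simp only [map_add, LinearMap.add_apply, ha, hb]
    | tmul m s =>
      rw [LinearMap.rTensor_tmul, hv]
      clear hv
      induction y using TensorProduct.induction_on with
      | zero => simp
      | add a b ha hb => simp only [map_add, TensorProduct.add_tmul, ha, hb]
      | tmul n t => simp [κ, k]
  exact key _ _ _ fun m => hb m S h

theorem bilinMap_ext [Module.Projective R M] {b b' : M →ₗ[R] M →ₗ[R] N}
    (H : ∀ (S : CommAlgCat.{u} R) (g h : G.obj S),
      bilinBaseChange b S (C.pt g) (C.pt h) = bilinBaseChange b' S (C.pt g) (C.pt h)) :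
    b = b' := by
  ext x y
  obtain ⟨T₁, g₁, l₁, rfl⟩ := C.exists_rid_lTensor_pt x
  obtain ⟨T₂, g₂, l₂, rfl⟩ := C.exists_rid_lTensor_pt y
  let i₁ : T₁ ⟶ .of R (T₁ ⊗[R] T₂) := CommAlgCat.ofHom Algebra.TensorProduct.includeLeft
  let i₂ : T₂ ⟶ .of R (T₁ ⊗[R] T₂) := CommAlgCat.ofHom Algebra.TensorProduct.includeRight
  let l : T₁ ⊗[R] T₂ →ₗ[R] R := LinearMap.mul' R R ∘ₗ TensorProduct.map l₁ l₂
  have h := H _ ((G.map i₁).hom g₁) ((G.map i₂).hom g₂)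
  rw [C.pt_map, C.pt_map] at h
  have h1 : ∀ (b : M →ₗ[R] M →ₗ[R] N) (x : M ⊗[R] T₁) (y : M ⊗[R] T₂),
      b (TensorProduct.rid R M (lTensor M l₁ x)) (TensorProduct.rid R M (lTensor M l₂ y)) =
        TensorProduct.rid R N (lTensor N l (bilinBaseChange b (T₁ ⊗[R] T₂)
          (lTensor M i₁.hom.toLinearMap x) (lTensor M i₂.hom.toLinearMap y))) := by
    intro b x y
    induction x using TensorProduct.induction_on with
    | zero => simp
    | add a b ha hb => simp only [map_add, LinearMap.add_apply, ha, hb]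
    | tmul m s =>
      induction y using TensorProduct.induction_on with
      | zero => simp
      | add a b ha hb => simp only [map_add, ha, hb]
      | tmul n t => simp [i₁, i₂, l, smul_smul, mul_comm]
  rw [h1, h1]
  exact congrArg (fun z => TensorProduct.rid R N (lTensor N l z)) h

/-- The element of `M` corresponding to the unit of `G(R)`. -/
noncomputable def unitPt : M := TensorProduct.rid R M (C.pt (1 : G.obj (.of R R)))

theorem pt_one (S : CommAlgCat.{u} R) : C.pt (1 : G.obj S) = C.unitPt ⊗ₜ[R] (1 : S) := by
  let f : CommAlgCat.of R R ⟶ S := CommAlgCat.ofHom (Algebra.ofId R S)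
  have h : (1 : G.obj S) = (G.map f).hom 1 := (map_one _).symm
  rw [h, C.pt_map, unitPt]
  generalize C.pt _ = x
  change M ⊗[R] R at x
  induction x using TensorProduct.induction_on with
  | zero => simp
  | add a b ha hb => simp only [map_add, TensorProduct.add_tmul, ha, hb]
  | tmul m r => simp [f, Algebra.ofId_apply, Algebra.algebraMap_eq_smul_one,
      TensorProduct.smul_tmul]

/-- The multiplication of a formal monoid is bilinear. -/
theorem exists_pt_mul_eq [Module.Projective R M] : ∃ b : M →ₗ[R] M →ₗ[R] M,
    (∀ (S : CommAlgCat.{u} R) (g h : G.obj S),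
      C.pt (g * h) = bilinBaseChange b S (C.pt g) (C.pt h)) ∧
    (∀ x y, b x y = b y x) ∧ (∀ x y z, b (b x y) z = b x (b y z)) ∧ ∀ x, b C.unitPt x = x := by
  obtain ⟨b, hb⟩ := C.exists_eq_bilinBaseChange (fun S g h => C.pt (g * h))
    (fun f g h => by rw [← map_mul, C.pt_map])
  refine ⟨b, hb, ?_, ?_, ?_⟩
  · have hflip : ∀ (S : CommAlgCat.{u} R) (x y : M ⊗[R] S),
        bilinBaseChange b.flip S x y = bilinBaseChange b S y x := by
      intro S x y
      induction x using TensorProduct.induction_on with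
      | zero => simp
      | add a b ha hb => simp only [map_add, LinearMap.add_apply, ha, hb]
      | tmul m s =>
        induction y using TensorProduct.induction_on with
        | zero => simp
        | add a b ha hb => simp only [map_add, LinearMap.add_apply, ha, hb]
        | tmul n t => simp [mul_comm]
    have h : b = b.flip := C.bilinMap_ext fun S g h => by rw [hflip, ← hb, ← hb, mul_comm]
    exact fun x y => LinearMap.congr_fun₂ h x y
  · intro x y z
    -- As points span `M`, associativity of `b` is checked on three points moved to `T₁ ⊗ (T₂ ⊗
    -- T₃)`, where it is associativity in `G`.
    obtain ⟨T₁, g₁, l₁, rfl⟩ := C.exists_rid_lTensor_pt x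
    obtain ⟨T₂, g₂, l₂, rfl⟩ := C.exists_rid_lTensor_pt y
    obtain ⟨T₃, g₃, l₃, rfl⟩ := C.exists_rid_lTensor_pt z
    let i₁ : T₁ ⟶ .of R (T₁ ⊗[R] (T₂ ⊗[R] T₃)) :=
      CommAlgCat.ofHom Algebra.TensorProduct.includeLeft
    let i₂ : T₂ ⟶ .of R (T₁ ⊗[R] (T₂ ⊗[R] T₃)) := CommAlgCat.ofHom
      (Algebra.TensorProduct.includeRight.comp Algebra.TensorProduct.includeLeft)
    let i₃ : T₃ ⟶ .of R (T₁ ⊗[R] (T₂ ⊗[R] T₃)) := CommAlgCat.ofHom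
      (Algebra.TensorProduct.includeRight.comp Algebra.TensorProduct.includeRight)
    let l : T₁ ⊗[R] (T₂ ⊗[R] T₃) →ₗ[R] R := LinearMap.mul' R R ∘ₗ TensorProduct.map l₁
      (LinearMap.mul' R R ∘ₗ TensorProduct.map l₂ l₃)
    have h : bilinBaseChange b _ (bilinBaseChange b _ (C.pt ((G.map i₁).hom g₁))
        (C.pt ((G.map i₂).hom g₂))) (C.pt ((G.map i₃).hom g₃)) =
        bilinBaseChange b _ (C.pt ((G.map i₁).hom g₁)) (bilinBaseChange b _
          (C.pt ((G.map i₂).hom g₂)) (C.pt ((G.map i₃).hom g₃))) := by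
      rw [← hb, ← hb, ← hb, ← hb, mul_assoc]
    rw [C.pt_map, C.pt_map, C.pt_map] at h
    have h1 : ∀ (x : M ⊗[R] T₁) (y : M ⊗[R] T₂) (z : M ⊗[R] T₃),
        b (b (TensorProduct.rid R M (lTensor M l₁ x)) (TensorProduct.rid R M (lTensor M l₂ y)))
          (TensorProduct.rid R M (lTensor M l₃ z)) =
          TensorProduct.rid R M (lTensor M l (bilinBaseChange b (T₁ ⊗[R] (T₂ ⊗[R] T₃))
            (bilinBaseChange b (T₁ ⊗[R] (T₂ ⊗[R] T₃)) (lTensor M i₁.hom.toLinearMap x)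
              (lTensor M i₂.hom.toLinearMap y)) (lTensor M i₃.hom.toLinearMap z))) := by
      intro x y z
      induction x using TensorProduct.induction_on with
      | zero => simp
      | add a b ha hb => simp only [map_add, LinearMap.add_apply, ha, hb]
      | tmul m s =>
        induction y using TensorProduct.induction_on with
        | zero => simp
        | add a b ha hb => simp only [map_add, LinearMap.add_apply, ha, hb]
        | tmul n t =>
          induction z using TensorProduct.induction_on with
          | zero => simp
          | add a b ha hb => simp only [map_add, ha, hb]
          | tmul p r => simp [i₁, i₂, i₃, l, smul_smul, mul_assoc, mul_comm]
    have h2 : ∀ (x : M ⊗[R] T₁) (y : M ⊗[R] T₂) (z : M ⊗[R] T₃),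
        b (TensorProduct.rid R M (lTensor M l₁ x)) (b (TensorProduct.rid R M (lTensor M l₂ y))
          (TensorProduct.rid R M (lTensor M l₃ z))) =
          TensorProduct.rid R M (lTensor M l (bilinBaseChange b (T₁ ⊗[R] (T₂ ⊗[R] T₃))
            (lTensor M i₁.hom.toLinearMap x) (bilinBaseChange b (T₁ ⊗[R] (T₂ ⊗[R] T₃))
              (lTensor M i₂.hom.toLinearMap y) (lTensor M i₃.hom.toLinearMap z)))) := by
      intro x y z
      induction x using TensorProduct.induction_on with
      | zero => simp
      | add a b ha hb => simp only [map_add, LinearMap.add_apply, ha, hb]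
      | tmul m s =>
        induction y using TensorProduct.induction_on with
        | zero => simp
        | add a b ha hb => simp only [map_add, LinearMap.add_apply, ha, hb]
        | tmul n t =>
          induction z using TensorProduct.induction_on with
          | zero => simp
          | add a b ha hb => simp only [map_add, ha, hb]
          | tmul p r => simp [i₁, i₂, i₃, l, smul_smul, mul_comm]
    rw [h1, h2]
    exact congrArg (fun z => TensorProduct.rid R M (lTensor M l z)) h
  · suffices b C.unitPt = LinearMap.id from fun x => by rw [this, LinearMap.id_apply]
    refine C.linearMap_ext fun S g => ?_
    have h := hb S 1 g
    rw [one_mul, C.pt_one] at h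
    rw [LinearMap.rTensor_id, LinearMap.id_apply]
    conv_rhs => rw [h]
    generalize C.pt g = x
    induction x using TensorProduct.induction_on with
    | zero => simp
    | add a b ha hb => simp only [map_add, ha, hb]
    | tmul m s => simp

/-- `M` carries the structure of a commutative algebra for which the points of `G` in `M ⊗ S`
multiply as in `G`. -/
theorem exists_algebra (C : FormalChart M G) [Module.Projective R M] :
    ∃ (A : CommAlgCat.{u} R) (C' : FormalChart A G),
    Nonempty (A ≃ₗ[R] M) ∧
    (∀ (S : CommAlgCat.{u} R) (g h : G.obj S), C'.pt (g * h) = (C'.pt g * C'.pt h : A ⊗[R] S)) ∧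
    ∀ S : CommAlgCat.{u} R, C'.pt (1 : G.obj S) = (1 : A ⊗[R] S) := by
  obtain ⟨b, hb, hcomm, hassoc, hone⟩ := C.exists_pt_mul_eq
  let iM : AddCommGroup M := inferInstance
  let iR : Module R M := inferInstance
  -- The ring is built on the given additive group, so `C` itself serves as the chart on the
  -- resulting algebra.
  let ring : CommRing M :=
    { iM with
      mul := fun x y => b x y
      one := C.unitPt
      mul_assoc := hassoc
      mul_comm := hcomm
      one_mul := hone
      mul_one := fun x => (hcomm x _).trans (hone x)
      left_distrib := fun x y z => map_add (b x) y z
      right_distrib := fun x y z => by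
        change b (x + y) z = b x z + b y z
        rw [map_add, LinearMap.add_apply]
      zero_mul := fun x => by
        change b 0 x = 0
        rw [map_zero, LinearMap.zero_apply]
      mul_zero := fun x => map_zero (b x) }
  let alg : Algebra R M := Algebra.ofModule
    (fun r x y => by
      change b (r • x) y = r • b x y
      rw [map_smul, LinearMap.smul_apply])
    (fun r x y => map_smul (b x) r y)
  have hmul : ∀ (S : CommAlgCat.{u} R) (x y : M ⊗[R] S),
      bilinBaseChange b S x y = (x * y : M ⊗[R] S) := by
    intro S x y
    induction x using TensorProduct.induction_on with
    | zero => simp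
    | add a b ha hb => simp only [map_add, LinearMap.add_apply, add_mul, ha, hb]
    | tmul m s =>
      induction y using TensorProduct.induction_on with
      | zero => simp
      | add a b ha hb => simp only [map_add, mul_add, ha, hb]
      | tmul n t =>
        rw [Algebra.TensorProduct.tmul_mul_tmul]
        rfl
  refine ⟨.of R M, C, ⟨LinearEquiv.refl R M⟩, fun S g h => ?_, fun S => ?_⟩
  · exact (hb S g h).trans (hmul S _ _)
  · exact C.pt_one S

end FormalChart

/-- A presentation of the functor of sets underlying `G` as `Spec A`. -/
structure AffineChart (A : CommAlgCat.{u} R) (G : MonFunctor R) where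
  equiv : ∀ S : CommAlgCat.{u} R, G.obj S ≃ (A ⟶ S)
  equiv_map : ∀ {S S' : CommAlgCat.{u} R} (f : S ⟶ S') (g : G.obj S),
    equiv S' ((G.map f).hom g) = equiv S g ≫ f

namespace AffineChart

variable {A : CommAlgCat.{u} R} {G : MonFunctor R}

/-- The chart given by an isomorphism of functors of sets. -/
def ofIso (i : G ⋙ forget CommMonCat ≅ affineScheme A) : AffineChart A G where
  equiv S := (i.app S).toEquiv.trans Equiv.ulift
  equiv_map f g := congrArg ULift.down (ConcreteCategory.congr_hom (i.hom.naturality f) g)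

/-- The isomorphism of functors of sets given by a chart. -/
def toIso (c : AffineChart A G) : G ⋙ forget CommMonCat ≅ affineScheme A :=
  NatIso.ofComponents (fun S => ((c.equiv S).trans Equiv.ulift.symm).toIso) fun f => by
    ext g
    exact congrArg ULift.up (c.equiv_map f g)

end AffineChart

/-- A chart of a formal monoid on the underlying module of an algebra `A`, for which the monoid
structure is induced by the multiplication of `A`. -/
structure CartierChart (A : CommAlgCat.{u} R) (G : MonFunctor R) extends FormalChart A G where
  pt_mul : ∀ {S : CommAlgCat.{u} R} (g h : G.obj S),
    toFormalChart.pt (g * h) = (toFormalChart.pt g * toFormalChart.pt h : A ⊗[R] S)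
  pt_one : ∀ S : CommAlgCat.{u} R, toFormalChart.pt (1 : G.obj S) = (1 : A ⊗[R] S)

/-! ### The dual of a formal monoid -/

namespace CartierChart

variable {A : CommAlgCat.{u} R} {G : MonFunctor R} (C : CartierChart A G) {S : CommAlgCat.{u} R}

/-- The character of `G` over `S` given by a morphism of algebras `A ⟶ S`. -/
noncomputable def character (k : A ⟶ S) : Character G S where
  app T s :=
    { toFun := fun g => Algebra.TensorProduct.productMap (k ≫ s).hom (AlgHom.id R T) (C.pt g)
      map_one' := by rw [C.pt_one, map_one]
      map_mul' := fun g h => by rw [C.pt_mul, map_mul] }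
  naturality {T T'} s f g := by
    change Algebra.TensorProduct.productMap (k ≫ s ≫ f).hom (AlgHom.id R T')
      (C.pt ((G.map f).hom g)) = f.hom (Algebra.TensorProduct.productMap (k ≫ s).hom
        (AlgHom.id R T) (C.pt g))
    rw [C.pt_map]
    generalize C.pt g = x
    induction x using TensorProduct.induction_on with
    | zero => simp
    | add a b ha hb => simp only [map_add, ha, hb]
    | tmul a t => simp

theorem character_app (k : A ⟶ S) {T : CommAlgCat.{u} R} (s : S ⟶ T) (g : G.obj T) :
    (C.character k).app T s g =
      Algebra.TensorProduct.productMap (k ≫ s).hom (AlgHom.id R T) (C.pt g) := rfl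

/-- The values of a character over `S ⊗ T` are the contractions of `k` with the points of `G`, which
determine `k` because points span. -/
theorem character_app_include (k : A ⟶ S) {T : CommAlgCat.{u} R} (g : G.obj T) :
    (C.character k).app (.of R (S ⊗[R] T))
        (CommAlgCat.ofHom Algebra.TensorProduct.includeLeft)
        ((G.map (CommAlgCat.ofHom Algebra.TensorProduct.includeRight)).hom g) =
      rTensor T k.hom.toLinearMap (C.pt g) := by
  rw [character_app, C.pt_map]
  generalize C.pt g = x
  induction x using TensorProduct.induction_on with
  | zero => simp
  | add a b ha hb => simp only [map_add, ha, hb]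
  | tmul a t => simp

theorem character_injective [Module.Projective R A] :
    Function.Injective (C.character (S := S)) := by
  intro k k' h
  have : k.hom.toLinearMap = k'.hom.toLinearMap := C.linearMap_ext fun T g => by
    rw [← character_app_include, h, character_app_include]
  ext x
  exact LinearMap.congr_fun this x

/-- Over `S ⊗ T`, a character is a natural map from `G` to a quasi-coherent module, hence a linear
map `w : A → S`. Its multiplicativity on points passes to `w` by `bilinMap_ext`, and the maps `S ⊗ T
→ T` recover all its values. -/
theorem character_surjective [Module.Projective R A] :
    Function.Surjective (C.character (S := S)) := by
  intro χ
  let inl (T : CommAlgCat.{u} R) : S ⟶ .of R (S ⊗[R] T) :=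
    CommAlgCat.ofHom Algebra.TensorProduct.includeLeft
  let inr (T : CommAlgCat.{u} R) : T ⟶ .of R (S ⊗[R] T) :=
    CommAlgCat.ofHom Algebra.TensorProduct.includeRight
  obtain ⟨w, hw⟩ := C.exists_eq_rTensor_pt (N := S)
    (fun T g => (χ.app _ (inl T) ((G.map (inr T)).hom g) : S ⊗[R] T)) (by
      intro T T' f g
      let k : CommAlgCat.of R (S ⊗[R] T) ⟶ .of R (S ⊗[R] T') :=
        CommAlgCat.ofHom (Algebra.TensorProduct.map (AlgHom.id R S) f.hom)
      have hl : inl T' = inl T ≫ k := by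
        ext x
        simp [inl, k]
      have hr : f ≫ inr T' = inr T ≫ k := by
        ext x
        simp [inr, k]
      rw [← CommMonCat.comp_apply, ← G.map_comp, hl, hr, G.map_comp, CommMonCat.comp_apply]
      exact χ.naturality (inl T) k _)
  have hmul : ∀ x y, w (x * y) = w x * w y := by
    let b : A →ₗ[R] A →ₗ[R] S := (LinearMap.mul R A).compr₂ w
    let b' : A →ₗ[R] A →ₗ[R] S := (LinearMap.mul R S).compl₁₂ w w
    have h1 : ∀ (T : CommAlgCat.{u} R) (x y : A ⊗[R] T),
        bilinBaseChange b T x y = rTensor T w (x * y) := by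
      intro T x y
      induction x using TensorProduct.induction_on with
      | zero => simp
      | add a b ha hb => simp only [map_add, LinearMap.add_apply, add_mul, ha, hb]
      | tmul m s =>
        induction y using TensorProduct.induction_on with
        | zero => simp
        | add a b ha hb => simp only [map_add, mul_add, ha, hb]
        | tmul n t => simp [b]
    have h2 : ∀ (T : CommAlgCat.{u} R) (x y : A ⊗[R] T),
        bilinBaseChange b' T x y = (rTensor T w x * rTensor T w y : S ⊗[R] T) := by
      intro T x y
      induction x using TensorProduct.induction_on with
      | zero => simp
      | add a b ha hb => simp only [map_add, LinearMap.add_apply, add_mul, ha, hb]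
      | tmul m s =>
        induction y using TensorProduct.induction_on with
        | zero => simp
        | add a b ha hb => simp only [map_add, mul_add, ha, hb]
        | tmul n t => simp [b']
    have h : b = b' := C.bilinMap_ext fun T g h => by
      rw [h1, h2, ← C.pt_mul, ← hw, ← hw, ← hw, map_mul, map_mul]
    exact fun x y => LinearMap.congr_fun₂ h x y
  have hone : w 1 = 1 := by
    have h := hw (.of R R) 1
    rw [map_one, map_one, C.pt_one] at h
    have h' := congrArg (TensorProduct.rid R S) h
    have h1 : TensorProduct.rid R S ((1 : S) ⊗ₜ[R] (1 : R)) = 1 := by simp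
    refine Eq.trans ?_ (h'.symm.trans h1)
    simp [Algebra.TensorProduct.one_def]
  refine ⟨CommAlgCat.ofHom (AlgHom.ofLinearMap w hone hmul), ?_⟩
  ext T s g
  let f : CommAlgCat.of R (S ⊗[R] T) ⟶ T :=
    CommAlgCat.ofHom (Algebra.TensorProduct.productMap s.hom (AlgHom.id R T))
  have hl : inl T ≫ f = s := by
    ext x
    simp [inl, f]
  have hr : inr T ≫ f = 𝟙 T := by
    ext x
    simp [inr, f]
  have h := χ.naturality (inl T) f ((G.map (inr T)).hom g)
  rw [hl, ← CommMonCat.comp_apply, ← G.map_comp, hr, G.map_id, CommMonCat.id_apply] at h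
  rw [h, character_app]
  refine Eq.trans ?_ (congrArg f.hom (hw T g)).symm
  generalize C.pt g = x
  induction x using TensorProduct.induction_on with
  | zero => simp
  | add a b ha hb => simp only [map_add, ha, hb]
  | tmul a t => simp [f]

/-- The dual of a formal monoid is affine. -/
noncomputable def dualChart [Module.Projective R A] : AffineChart A (dualObj G) where
  equiv S :=
    (Equiv.ofBijective C.character ⟨C.character_injective, C.character_surjective⟩).symm
  equiv_map {S S'} f χ := by
    obtain ⟨k, rfl⟩ := C.character_surjective χ
    have h : ((dualObj G).map f).hom (C.character k) = C.character (k ≫ f) := by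
      refine Character.ext (funext fun T => funext fun s => MonoidHom.ext fun g => ?_)
      exact (C.character_app k (f ≫ s) g).trans (by rw [character_app, Category.assoc])
    rw [h]
    apply C.character_injective
    exact (Equiv.ofBijective_apply_symm_apply _ _ _).trans
      (congrArg C.character (congrArg (· ≫ f) (Equiv.ofBijective_symm_apply_apply _ _ k))).symm

end CartierChart

/-- The functor of commutative algebras `T ↦ Hom(C, T)`, with the convolution product, for a
cocommutative coalgebra `C`. -/
noncomputable def convolutionFunctor (C : Type u) [AddCommGroup C] [Module R C] [Coalgebra R C]
    [Coalgebra.IsCocomm R C] : CommAlgFunctor R where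
  obj T := WithConv (C →ₗ[R] T)
  map f :=
    { toFun := fun w => WithConv.toConv (f.hom.toLinearMap ∘ₗ w.ofConv)
      map_one' := by
        ext x
        simp
      map_mul' := fun w v => WithConv.ofConv_injective
        (LinearMap.algHom_comp_convMul_distrib f.hom w v)
      map_zero' := by
        ext x
        simp
      map_add' := fun w v => by
        ext x
        simp }
  map_algebraMap f t := by
    ext x
    simp
  map_id T a := rfl
  map_comp f g a := rfl

/-- The module scheme underlying `convolutionFunctor C`. -/
noncomputable def convolutionIso (C : Type u) [AddCommGroup C] [Module R C] [Coalgebra R C]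
    [Coalgebra.IsCocomm R C] : ModuleSchemeIso C (convolutionFunctor (R := R) C) where
  equiv T := (WithConv.linearEquiv T (C →ₗ[R] T)).symm
  naturality _ _ := rfl

/-! ### The dual of an affine monoid scheme -/

namespace AffineChart

variable {A : CommAlgCat.{u} R} {G : MonFunctor R} (c : AffineChart A G)
  {S T : CommAlgCat.{u} R}

/-- The product of points of `Spec A`. -/
def conv (k k' : A ⟶ S) : A ⟶ S := c.equiv S ((c.equiv S).symm k * (c.equiv S).symm k')

/-- The unit of the monoid of points of `Spec A`. -/
def unit (S : CommAlgCat.{u} R) : A ⟶ S := c.equiv S 1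

theorem equiv_mul (g h : G.obj S) : c.equiv S (g * h) = c.conv (c.equiv S g) (c.equiv S h) := by
  simp [conv]

theorem symm_conv (k k' : A ⟶ S) :
    (c.equiv S).symm (c.conv k k') = (c.equiv S).symm k * (c.equiv S).symm k' := by
  simp [conv]

theorem symm_unit (S : CommAlgCat.{u} R) : (c.equiv S).symm (c.unit S) = 1 := by
  simp [unit]

theorem map_symm (f : S ⟶ T) (k : A ⟶ S) :
    (G.map f).hom ((c.equiv S).symm k) = (c.equiv T).symm (k ≫ f) := by
  apply (c.equiv T).injective
  simp [c.equiv_map]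

theorem conv_comp (k k' : A ⟶ S) (f : S ⟶ T) :
    c.conv k k' ≫ f = c.conv (k ≫ f) (k' ≫ f) := by
  rw [conv, ← c.equiv_map, map_mul, map_symm, map_symm, conv]

theorem unit_comp (f : S ⟶ T) : c.unit S ≫ f = c.unit T := by
  rw [unit, ← c.equiv_map, map_one, unit]

theorem conv_assoc (k k' k'' : A ⟶ S) :
    c.conv (c.conv k k') k'' = c.conv k (c.conv k' k'') := by
  simp [conv, mul_assoc]

theorem conv_comm (k k' : A ⟶ S) : c.conv k k' = c.conv k' k := by
  simp [conv, mul_comm]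

theorem unit_conv (k : A ⟶ S) : c.conv (c.unit S) k = k := by
  simp [conv, unit]

theorem conv_unit (k : A ⟶ S) : c.conv k (c.unit S) = k := by
  simp [conv, unit]

/-- The first inclusion `A ⟶ A ⊗ S`. -/
abbrev inl (A S : CommAlgCat.{u} R) : A ⟶ .of R (A ⊗[R] S) :=
  CommAlgCat.ofHom Algebra.TensorProduct.includeLeft

/-- The second inclusion `S ⟶ A ⊗ S`. -/
abbrev inr (A S : CommAlgCat.{u} R) : S ⟶ .of R (A ⊗[R] S) :=
  CommAlgCat.ofHom Algebra.TensorProduct.includeRight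

/-- The comultiplication of `A`. -/
def comul : A ⟶ .of R (A ⊗[R] A) := c.conv (inl A A) (inr A A)

/-- The counit of `A`. -/
def counit : A ⟶ .of R R := c.unit _

theorem comul_comp (f : .of R (A ⊗[R] A) ⟶ S) :
    c.comul ≫ f = c.conv (inl A A ≫ f) (inr A A ≫ f) := c.conv_comp _ _ _

/-- The bialgebra structure on `A`. -/
noncomputable abbrev bialgebra : Bialgebra R A := Bialgebra.ofAlgHom c.comul.hom c.counit.hom
  (by
    -- Coassociativity is associativity of `conv` for the three inclusions of `A` in `A ⊗ (A ⊗ A)`.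
    let j : CommAlgCat.of R (A ⊗[R] A) ⟶ .of R (A ⊗[R] (A ⊗[R] A)) := CommAlgCat.ofHom
      ((Algebra.TensorProduct.assoc R R R A A A).toAlgHom.comp
        Algebra.TensorProduct.includeLeft)
    let f : CommAlgCat.of R (A ⊗[R] A) ⟶ .of R (A ⊗[R] (A ⊗[R] A)) := CommAlgCat.ofHom
      ((Algebra.TensorProduct.assoc R R R A A A).toAlgHom.comp
        (Algebra.TensorProduct.map c.comul.hom (.id R A)))
    let f' : CommAlgCat.of R (A ⊗[R] A) ⟶ .of R (A ⊗[R] (A ⊗[R] A)) := CommAlgCat.ofHom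
      (Algebra.TensorProduct.map (.id R A) c.comul.hom)
    have h1 : inl A A ≫ f = c.comul ≫ j := by
      ext x
      simp [f, j]
    have h2 : inr A A ≫ f' = c.comul ≫ inr A (.of R (A ⊗[R] A)) := by
      ext x
      simp [f']
    have h3 : c.comul ≫ f = c.comul ≫ f' := by
      rw [comul_comp, comul_comp, h1, h2, comul_comp, comul_comp, conv_assoc]
      congr 1
      · ext x
        simp [f', j]
        rfl
      · congr 1
        ext x
        simp [f]
        rfl
    exact congrArg CommAlgCat.Hom.hom h3)
  (by
    let f : CommAlgCat.of R (A ⊗[R] A) ⟶ .of R (R ⊗[R] A) := CommAlgCat.ofHom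
      (Algebra.TensorProduct.map c.counit.hom (.id R A))
    have h1 : inl A A ≫ f = c.counit ≫ inl (.of R R) A := by
      ext x
      simp [f]
    have h3 : c.comul ≫ f = inr (.of R R) A := by
      rw [comul_comp, h1, counit, unit_comp, unit_conv]
      ext x
      simp [f]
    refine (congrArg CommAlgCat.Hom.hom h3).trans ?_
    ext x
    rfl)
  (by
    let f : CommAlgCat.of R (A ⊗[R] A) ⟶ .of R (A ⊗[R] R) := CommAlgCat.ofHom
      (Algebra.TensorProduct.map (.id R A) c.counit.hom)
    have h1 : inr A A ≫ f = c.counit ≫ inr A (.of R R) := by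
      ext x
      simp [f]
    have h3 : c.comul ≫ f = inl A (.of R R) := by
      rw [comul_comp, h1, counit, unit_comp, conv_unit]
      ext x
      simp [f]
    refine (congrArg CommAlgCat.Hom.hom h3).trans ?_
    ext x
    rfl)

/-- Recording the product and unit by formulas lets the results on characters below apply to any
algebra scheme structure satisfying them; the double dual of a formal monoid needs this. -/
theorem exists_convolution : ∃ (𝔸 : CommAlgFunctor R) (e : ModuleSchemeIso A 𝔸),
    (∀ (T : CommAlgCat.{u} R) (w v : A →ₗ[R] T), e.mul w v =
      LinearMap.mul' R T ∘ₗ TensorProduct.map w v ∘ₗ c.comul.hom.toLinearMap) ∧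
    ∀ T : CommAlgCat.{u} R, e.one T = (c.unit T).hom.toLinearMap := by
  let _ : Bialgebra R A := c.bialgebra
  have : Coalgebra.IsCocomm R A := ⟨by
    let f : CommAlgCat.of R (A ⊗[R] A) ⟶ .of R (A ⊗[R] A) := CommAlgCat.ofHom
      (Algebra.TensorProduct.comm R A A).toAlgHom
    have h1 : inl A A ≫ f = inr A A := by
      ext x
      simp [f]
    have h2 : inr A A ≫ f = inl A A := by
      ext x
      simp [f]
    have h3 : c.comul ≫ f = c.comul := by
      rw [comul_comp, h1, h2, conv_comm, comul]
    exact congrArg (fun k => k.hom.toLinearMap) h3⟩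
  refine ⟨convolutionFunctor A, convolutionIso A, fun T w v => rfl, fun T => ?_⟩
  have h : c.unit T = c.counit ≫ CommAlgCat.ofHom (Algebra.ofId R T) := (c.unit_comp _).symm
  rw [h]
  rfl

/-- The universal value of a character of `Spec A`. -/
def univValue (χ : Character G S) : A ⊗[R] S :=
  χ.app _ (inr A S) ((c.equiv _).symm (inl A S))

/-- Yoneda: the point `g` over `s : S ⟶ T` is the specialization of the generic point over `A ⊗ S`.
-/
theorem app_eq_productMap (χ : Character G S) (s : S ⟶ T) (g : G.obj T) :
    χ.app T s g = Algebra.TensorProduct.productMap (c.equiv T g).hom s.hom (c.univValue χ) := by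
  let f : CommAlgCat.of R (A ⊗[R] S) ⟶ T :=
    CommAlgCat.ofHom (Algebra.TensorProduct.productMap (c.equiv T g).hom s.hom)
  have hl : inl A S ≫ f = c.equiv T g := by
    ext x
    simp [f]
  have hr : inr A S ≫ f = s := by
    ext x
    simp [f]
  have h := χ.naturality (inr A S) f ((c.equiv _).symm (inl A S))
  rw [hr, map_symm, hl, Equiv.symm_apply_apply] at h
  exact h

theorem rTensor_univValue (χ : Character G S) (k : A ⟶ T) :
    rTensor S k.hom.toLinearMap (c.univValue χ) =
      χ.app (.of R (T ⊗[R] S)) (inr T S) ((c.equiv _).symm (k ≫ inl T S)) := by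
  rw [app_eq_productMap, Equiv.apply_symm_apply]
  generalize c.univValue χ = x
  induction x using TensorProduct.induction_on with
  | zero => simp
  | add a b ha hb => simp only [map_add, ha, hb]
  | tmul a t => simp

theorem univValue_restrict {S' : CommAlgCat.{u} R} (χ : Character G S) (f : S ⟶ S') :
    c.univValue (Character.restrict f χ) = lTensor A f.hom.toLinearMap (c.univValue χ) := by
  change χ.app _ (f ≫ inr A S') _ = _
  rw [app_eq_productMap, Equiv.apply_symm_apply]
  generalize c.univValue χ = x
  induction x using TensorProduct.induction_on with
  | zero => simp
  | add a b ha hb => simp only [map_add, ha, hb]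
  | tmul a t => simp

section

variable {𝔸 : CommAlgFunctor R} (e : ModuleSchemeIso A 𝔸)
  (hmul : ∀ (T : CommAlgCat.{u} R) (w v : A →ₗ[R] T), e.mul w v =
    LinearMap.mul' R T ∘ₗ TensorProduct.map w v ∘ₗ c.comul.hom.toLinearMap)
  (hone : ∀ T : CommAlgCat.{u} R, e.one T = (c.unit T).hom.toLinearMap)

include hmul in
theorem mul_toLinearMap (k k' : A ⟶ T) :
    e.mul k.hom.toLinearMap k'.hom.toLinearMap = (c.conv k k').hom.toLinearMap := by
  let f : CommAlgCat.of R (A ⊗[R] A) ⟶ T :=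
    CommAlgCat.ofHom (Algebra.TensorProduct.productMap k.hom k'.hom)
  have hl : inl A A ≫ f = k := by
    ext x
    simp [f]
  have hr : inr A A ≫ f = k' := by
    ext x
    simp [f]
  have h := c.comul_comp f
  rw [hl, hr] at h
  rw [hmul, ← h, ← LinearMap.comp_assoc]
  change _ = f.hom.toLinearMap ∘ₗ c.comul.hom.toLinearMap
  congr 1
  ext x y
  simp [f]

include hmul hone in
-- Multiplicativity of `χ` on the universal pair of points, over `(A ⊗ A) ⊗ S`, says that the
-- universal value is grouplike. `rTensor_convolution` carries this from algebra morphisms to all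
-- linear maps.
theorem isPoint_univValue (χ : Character G S) : e.IsPoint (c.univValue χ) where
  mul T w v := by
    rw [hmul]
    refine rTensor_convolution _ ?_ w v
    have h := c.rTensor_univValue χ c.comul
    have h' : c.comul ≫ inl (.of R (A ⊗[R] A)) S = c.conv
        (inl A A ≫ inl (.of R (A ⊗[R] A)) S) (inr A A ≫ inl (.of R (A ⊗[R] A)) S) :=
      c.comul_comp _
    rw [h', symm_conv, map_mul, ← rTensor_univValue, ← rTensor_univValue] at h
    exact h
  one T := by
    rw [hone, rTensor_univValue, unit_comp, symm_unit, map_one]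

/-- The character of `Spec A` given by a point of the spectrum of the dual of `A`. -/
noncomputable def characterOfPoint {x : A ⊗[R] S} (hx : e.IsPoint x) : Character G S where
  app T s :=
    { toFun := fun g => Algebra.TensorProduct.productMap (AlgHom.id R T) s.hom
        (rTensor S (c.equiv T g).hom.toLinearMap x)
      map_one' := by
        change Algebra.TensorProduct.productMap (AlgHom.id R T) s.hom
          (rTensor S (c.unit T).hom.toLinearMap x) = 1
        rw [← hone, hx.one, map_one]
      map_mul' := fun g h => by
        rw [equiv_mul, ← c.mul_toLinearMap e hmul, hx.mul, map_mul] }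
  naturality {T T'} s f g := by
    change Algebra.TensorProduct.productMap (AlgHom.id R T') (s ≫ f).hom
        (rTensor S (c.equiv T' ((G.map f).hom g)).hom.toLinearMap x) =
      f.hom (Algebra.TensorProduct.productMap (AlgHom.id R T) s.hom
        (rTensor S (c.equiv T g).hom.toLinearMap x))
    rw [equiv_map]
    clear hx
    induction x using TensorProduct.induction_on with
    | zero => simp
    | add a b ha hb => simp only [map_add, ha, hb]
    | tmul a t => simp

theorem univValue_characterOfPoint {x : A ⊗[R] S} (hx : e.IsPoint x) :
    c.univValue (c.characterOfPoint e hmul hone hx) = x := by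
  change Algebra.TensorProduct.productMap (AlgHom.id R (A ⊗[R] S)) (inr A S).hom
    (rTensor S (c.equiv _ ((c.equiv _).symm (inl A S))).hom.toLinearMap x) = x
  rw [Equiv.apply_symm_apply]
  clear hx
  induction x using TensorProduct.induction_on with
  | zero => simp
  | add a b ha hb => simp only [map_add, ha, hb]
  | tmul a t => simp

theorem univValue_injective : Function.Injective (c.univValue (S := S)) := by
  intro χ ψ h
  ext T s g
  rw [c.app_eq_productMap, h, ← c.app_eq_productMap]

/-- Characters of `Spec A` are the points of the spectrum of the dual of `A`. -/
noncomputable def characterEquiv (S : CommAlgCat.{u} R) :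
    Character G S ≃ 𝔸.Hom (quasiCoherent S) where
  toFun χ := e.ofPoint (c.isPoint_univValue e hmul hone χ)
  invFun φ := c.characterOfPoint e hmul hone (e.isPoint_point φ)
  left_inv χ := c.univValue_injective (by
    rw [univValue_characterOfPoint, ModuleSchemeIso.point_ofPoint])
  right_inv φ := e.point_injective (by
    rw [ModuleSchemeIso.point_ofPoint, univValue_characterOfPoint])

/-- The dual of an affine monoid scheme is formal. -/
noncomputable def formalChart : FormalChart A (dualObj G) where
  alg := 𝔸
  dualIso := e
  iso := NatIso.ofComponents (fun S => (c.characterEquiv e hmul hone S).toIso) fun {S S'} f => by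
    ext χ
    refine e.point_injective ?_
    refine Eq.trans ?_ (e.point_map f rfl).symm
    refine (e.point_ofPoint (c.isPoint_univValue e hmul hone (Character.restrict f χ))).trans ?_
    refine (c.univValue_restrict χ f).trans ?_
    exact congrArg _ (e.point_ofPoint (c.isPoint_univValue e hmul hone χ)).symm

theorem pt_formalChart (χ : Character G S) :
    (c.formalChart e hmul hone).pt (S := S) χ = c.univValue χ :=
  e.point_ofPoint (c.isPoint_univValue e hmul hone χ)

end

/-- Since characters multiply pointwise, their universal values multiply in `A ⊗ S`: the algebra
attached to the formal monoid `G^*` is `A` again. -/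
theorem exists_cartierChart : ∃ C : CartierChart A (dualObj G),
    ∀ (S : CommAlgCat.{u} R) (χ : Character G S), C.pt (S := S) χ = c.univValue χ := by
  obtain ⟨𝔸, e, hmul, hone⟩ := c.exists_convolution
  refine ⟨{ c.formalChart e hmul hone with pt_mul := fun {S} χ ψ => ?_, pt_one := fun S => ?_ },
    fun S χ => c.pt_formalChart e hmul hone χ⟩
  · refine (c.pt_formalChart e hmul hone (S := S) (_ : Character G S)).trans ?_
    exact congrArg₂ (fun x y : A ⊗[R] S => x * y) (c.pt_formalChart e hmul hone χ).symm
      (c.pt_formalChart e hmul hone ψ).symm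
  · exact c.pt_formalChart e hmul hone (S := S) (1 : Character G S)

end AffineChart

/-! ### The morphism to the double dual -/

theorem isIso_bidual_of_bijective {G : MonFunctor R}
    (h : ∀ S, Function.Bijective ((bidual G).app S).hom) : IsIso (bidual G) := by
  have : ∀ S, IsIso ((bidual G).app S) := fun S =>
    (ConcreteCategory.isIso_iff_bijective _).mpr (h S)
  exact NatIso.isIso_of_isIso_app _

/-- On `S`-points, `bidual` is the identification of `G(S)` with `A ⟶ S` followed by the bijection
of the latter with the characters of the formal monoid `G^*`. -/
theorem AffineChart.isIso_bidual {A : CommAlgCat.{u} R} {G : MonFunctor R}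
    (c : AffineChart A G) [Module.Projective R A] : IsIso (bidual G) := by
  obtain ⟨C, hC⟩ := c.exists_cartierChart
  refine isIso_bidual_of_bijective fun S => ?_
  have h : ∀ g : G.obj S, ((bidual G).app S).hom g = C.character (c.equiv S g) := by
    intro g
    refine Character.ext (funext fun T => funext fun s =>
      MonoidHom.ext fun (χ : Character G T) => ?_)
    change Character.app χ T (𝟙 T) ((G.map s).hom g) = Algebra.TensorProduct.productMap
      (c.equiv S g ≫ s).hom (AlgHom.id R T) (C.pt χ)
    rw [c.app_eq_productMap χ (𝟙 T), c.equiv_map, hC]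
    rfl
  have h' : ⇑((bidual G).app S).hom = C.character ∘ c.equiv S := funext h
  rw [h']
  exact Function.Bijective.comp ⟨C.character_injective, C.character_surjective⟩
    (c.equiv S).bijective

namespace CartierChart

variable {A : CommAlgCat.{u} R} {G : MonFunctor R} (C : CartierChart A G)
  {S T : CommAlgCat.{u} R} [Module.Projective R A]

theorem dualChart_symm (k : A ⟶ S) : (C.dualChart.equiv S).symm k = C.character k := rfl

/-- Tested against points of `G`: contraction with a point respects the product of `𝔸`, while `conv`
is the pointwise product of characters. -/
theorem mul_toLinearMap (k k' : A ⟶ T) :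
    C.dualIso.mul k.hom.toLinearMap k'.hom.toLinearMap =
      (C.dualChart.conv k k').hom.toLinearMap := by
  refine C.linearMap_ext fun S g => ?_
  rw [(C.isPoint_pt g).mul, ← character_app_include, ← character_app_include,
    ← character_app_include, ← dualChart_symm C (C.dualChart.conv k k'),
    AffineChart.symm_conv]
  rfl

theorem one_eq_toLinearMap (T : CommAlgCat.{u} R) :
    C.dualIso.one T = (C.dualChart.unit T).hom.toLinearMap := by
  refine C.linearMap_ext fun S g => ?_
  rw [(C.isPoint_pt g).one, ← character_app_include, ← dualChart_symm C (C.dualChart.unit T),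
    AffineChart.symm_unit]
  rfl

/-- The product is given by some `d` in `A ⊗ A` (`exists_comul`). Evaluation on the two inclusions
`A ⟶ A ⊗ A`, which are algebra morphisms, identifies `d` with the comultiplication of the dual. -/
theorem mul_eq_convolution (w v : A →ₗ[R] T) : C.dualIso.mul w v =
    LinearMap.mul' R T ∘ₗ TensorProduct.map w v ∘ₗ C.dualChart.comul.hom.toLinearMap := by
  ext a
  obtain ⟨d, hd⟩ := C.dualIso.exists_comul a
  have h := hd (.of R (A ⊗[R] A)) (AffineChart.inl A A).hom.toLinearMap
    (AffineChart.inr A A).hom.toLinearMap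
  rw [mul_toLinearMap] at h
  have h' : C.dualChart.comul.hom a = d := by
    refine h.trans ?_
    generalize d = y
    induction y using TensorProduct.induction_on with
    | zero => simp
    | add a b ha hb => simp only [map_add, ha, hb]
    | tmul a t => simp
  rw [hd, ← h']
  rfl

theorem univValue_bidual (g : G.obj S) :
    C.dualChart.univValue (((bidual G).app S).hom g : Character (dualObj G) S) = C.pt g := by
  change Algebra.TensorProduct.productMap (AffineChart.inl A S ≫ 𝟙 _).hom (AlgHom.id R _)
    (C.pt ((G.map (AffineChart.inr A S)).hom g)) = _
  rw [C.pt_map]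
  generalize C.pt g = x
  induction x using TensorProduct.induction_on with
  | zero => simp
  | add a b ha hb => simp only [map_add, ha, hb]
  | tmul a t => simp

/-- A character of `G^*` and a point of `G` are both determined by an element of `A ⊗ S`. By
`mul_eq_convolution`, being a point means the same for both, and `bidual` preserves the element. -/
theorem isIso_bidual (C : CartierChart A G) : IsIso (bidual G) := by
  refine isIso_bidual_of_bijective fun S => ⟨fun g g' h => ?_, fun θ => ?_⟩
  · apply C.pt_injective
    rw [← univValue_bidual, ← univValue_bidual, h]
  · obtain ⟨g, hg⟩ := C.exists_pt_eq (C.dualChart.isPoint_univValue C.dualIso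
      (fun T w v => C.mul_eq_convolution w v) C.one_eq_toLinearMap θ)
    exact ⟨g, C.dualChart.univValue_injective ((C.univValue_bidual g).trans hg)⟩

end CartierChart

/-- The naturality of the morphism to the bidual. -/
theorem bidual_naturality {G H : MonFunctor R} (α : G ⟶ H) :
    α ≫ bidual H = bidual G ≫ (dual R).map ((dual R).map α.op).op := by
  ext S g
  refine Character.ext (funext fun T => funext fun s => MonoidHom.ext fun χ => ?_)
  change Character.app χ T (𝟙 T) ((H.map s).hom ((α.app S).hom g)) =
    Character.app χ T (𝟙 T) ((α.app T).hom ((G.map s).hom g))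
  exact congrArg _ (ConcreteCategory.congr_hom (α.naturality s) g).symm

theorem isFormalOn_dualObj {M : Type u} [AddCommGroup M] [Module R M] {G : MonFunctor R}
    (h : IsAffineOn M G) : IsFormalOn M (dualObj G) := by
  obtain ⟨A, ⟨ψ⟩, ⟨i⟩⟩ := h
  obtain ⟨C, -⟩ := (AffineChart.ofIso i).exists_cartierChart
  exact ⟨C.alg, ⟨{
    equiv := fun T => (LinearEquiv.congrLeft T T ψ.symm).trans (C.dualIso.equiv T)
    naturality := fun f w => C.dualIso.naturality f (w ∘ₗ ψ.toLinearMap) }⟩, ⟨C.iso⟩⟩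

/-- This replaces the bare module `M` by the algebra that the monoid law puts on it. -/
theorem exists_cartierChart_of_isFormalOn {M : Type u} [AddCommGroup M] [Module R M]
    [Module.Projective R M] {G : MonFunctor R} (h : IsFormalOn M G) :
    ∃ A : CommAlgCat.{u} R, Nonempty (A ≃ₗ[R] M) ∧ Nonempty (CartierChart A G) := by
  obtain ⟨𝔸, ⟨e⟩, ⟨j⟩⟩ := h
  obtain ⟨A, C, hA, hmul, hone⟩ := FormalChart.exists_algebra ⟨𝔸, e, j⟩
  exact ⟨A, hA, ⟨{ C with pt_mul := fun g h => hmul _ g h, pt_one := hone }⟩⟩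

theorem isAffineOn_dualObj {M : Type u} [AddCommGroup M] [Module R M] [Module.Projective R M]
    {G : MonFunctor R} (h : IsFormalOn M G) : IsAffineOn M (dualObj G) := by
  obtain ⟨A, ⟨ψ⟩, ⟨C⟩⟩ := exists_cartierChart_of_isFormalOn h
  have := Module.Projective.of_equiv ψ.symm
  exact ⟨A, ⟨ψ⟩, ⟨C.dualChart.toIso⟩⟩

theorem IsAffineMonoidScheme.isIso_bidual {G : MonFunctor R} (h : IsAffineMonoidScheme R G) :
    IsIso (bidual G) := by
  obtain ⟨M, _, _, _, A, ⟨ψ⟩, ⟨i⟩⟩ := h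
  have := Module.Projective.of_equiv ψ.symm
  exact (AffineChart.ofIso i).isIso_bidual

theorem IsFormalMonoid.isIso_bidual {G : MonFunctor R} (h : IsFormalMonoid R G) :
    IsIso (bidual G) := by
  obtain ⟨M, _, _, _, h⟩ := h
  obtain ⟨A, ⟨ψ⟩, ⟨C⟩⟩ := exists_cartierChart_of_isFormalOn h
  have := Module.Projective.of_equiv ψ.symm
  exact C.isIso_bidual

theorem IsAffineMonoidScheme.dualObj {G : MonFunctor R} (h : IsAffineMonoidScheme R G) :
    IsFormalMonoid R (dualObj G) := by
  obtain ⟨M, _, _, _, h⟩ := h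
  exact ⟨M, _, _, inferInstance, isFormalOn_dualObj h⟩

theorem IsFormalMonoid.dualObj {G : MonFunctor R} (h : IsFormalMonoid R G) :
    IsAffineMonoidScheme R (dualObj G) := by
  obtain ⟨M, _, _, _, h⟩ := h
  exact ⟨M, _, _, inferInstance, isAffineOn_dualObj h⟩

/-! ### The anti-equivalence -/

section Equivalence

variable (hA : ∀ G : MonFunctor R, IsAffineMonoidScheme R G → IsFormalMonoid R (dualObj G))
  (hF : ∀ G : MonFunctor R, IsFormalMonoid R G → IsAffineMonoidScheme R (dualObj G))

/-- The isomorphism from the identity to the double dual, on affine monoid schemes. -/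
noncomputable def affineBidualIso : 𝟭 _ ≅ dualOfAffine hA ⋙ dualOfFormal hF :=
  -- In the opposite category `bidual` points from the double dual to the identity, hence the final
  -- `symm`.
  (NatIso.ofComponents (F := dualOfAffine hA ⋙ dualOfFormal hF) (G := 𝟭 _) (fun X =>
    have : IsIso (bidual X.unop.obj) := IsAffineMonoidScheme.isIso_bidual X.unop.property
    ((IsAffineMonoidScheme R).isoMk (X := X.unop)
      (Y := ((dualOfAffine hA ⋙ dualOfFormal hF).obj X).unop)
      (@asIso _ _ _ _ (bidual X.unop.obj) this)).op)
    fun {X Y} f => by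
      apply Quiver.Hom.unop_inj
      ext1
      exact (bidual_naturality f.unop.hom).symm).symm

/-- The isomorphism from the identity to the double dual, on formal monoids. -/
noncomputable def formalBidualIso : 𝟭 _ ≅ dualOfFormal hF ⋙ dualOfAffine hA :=
  NatIso.ofComponents (F := 𝟭 _) (G := dualOfFormal hF ⋙ dualOfAffine hA) (fun X =>
    have : IsIso (bidual X.obj) := IsFormalMonoid.isIso_bidual X.property
    (IsFormalMonoid R).isoMk (X := X)
      (Y := (dualOfFormal hF ⋙ dualOfAffine hA).obj X) (@asIso _ _ _ _ (bidual X.obj) this))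
    fun {X Y} f => by
      ext1
      exact bidual_naturality f.hom

/-- Cartier duality as an anti-equivalence. -/
noncomputable def cartierEquivalence :
    (IsAffineMonoidScheme R).FullSubcategoryᵒᵖ ≌ (IsFormalMonoid R).FullSubcategory :=
  CategoryTheory.Equivalence.mk (dualOfAffine hA) (dualOfFormal hF) (affineBidualIso hA hF)
    (formalBidualIso hA hF).symm

end Equivalence

end FunctorialCartier

theorem mainTheorem6 (R : Type u) [CommRing R] :
    (∀ (M : Type u) [AddCommGroup M] [Module R M] [Module.Projective R M] (G : MonFunctor R),
      (IsAffineOn M G → IsFormalOn M (dualObj G)) ∧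
      (IsFormalOn M G → IsAffineOn M (dualObj G))) ∧
    (∀ G : MonFunctor R, IsAffineMonoidScheme R G ∨ IsFormalMonoid R G → IsIso (bidual G)) ∧
    ∃ (hA : ∀ G : MonFunctor R, IsAffineMonoidScheme R G → IsFormalMonoid R (dualObj G))
      (hF : ∀ G : MonFunctor R, IsFormalMonoid R G → IsAffineMonoidScheme R (dualObj G)),
      (dualOfAffine hA).IsEquivalence ∧ (dualOfFormal hF).IsEquivalence ∧
      ∃ (η : 𝟭 _ ≅ dualOfAffine hA ⋙ dualOfFormal hF)
        (ε : 𝟭 _ ≅ dualOfFormal hF ⋙ dualOfAffine hA),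
        (∀ G : (IsAffineMonoidScheme R).FullSubcategory,
          (η.inv.app (op G)).unop.hom = bidual G.obj) ∧
        (∀ G : (IsFormalMonoid R).FullSubcategory, (ε.hom.app G).hom = bidual G.obj) := by
  refine ⟨fun M _ _ _ G => ⟨isFormalOn_dualObj, isAffineOn_dualObj⟩,
    fun G h => h.elim (·.isIso_bidual) (·.isIso_bidual),
    fun G h => h.dualObj, fun G h => h.dualObj, ?_, ?_, affineBidualIso _ _,
    formalBidualIso _ _, fun G => rfl, fun G => rfl⟩
  · exact (cartierEquivalence (fun _ h => h.dualObj) fun _ h => h.dualObj).isEquivalence_functor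
  · exact (cartierEquivalence (fun _ h => h.dualObj) fun _ h => h.dualObj).isEquivalence_inverse
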